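/- Let $n_1,n_2,n_3>1$ be integers, let $\mathfrak g=\mathfrak{so}_{2(n_1+n_2+n_3)+1}$ with Killing form $B$, and let $\mathfrak h=\mathfrak u_{n_1}\oplus\mathfrak u_{n_2}\oplus\mathfrak{so}_{2n_3+1}\subset\mathfrak g$ be the Lie algebra of the isotropy group of the flag manifold $M_{n_1,n_2,n_3}=SO_{2(n_1+n_2+n_3)+1}/U_{n_1}\times U_{n_2}\times SO_{2n_3+1}$, embedded through diagonal blocks via $\mathbb R^{2(n_1+n_2+n_3)+1}=\mathbb C^{n_1}\oplus\mathbb C^{n_2}\oplus\mathbb R^{2n_3+1}$. Let $\mathfrak m$ be the $B$-orthogonal complement of $\mathfrak h$ in $\mathfrak g$. For $a,b\in\mathbb R$ let $Z_{a,b}=(\sqrt{-1}\,a\,\mathrm{Id},\sqrt{-1}\,b\,\mathrm{Id},0)$ be the general element of the centre of $\mathfrak h$, and put $$\omega_1=2a,\quad \omega_2=2b,\quad \omega_3=a-b,\quad \omega_4=a+b,\quad \omega_5=a,\quad \omega_6=b.$$ For $1\le i\le 6$ let $\mathfrak m_i\subset\mathfrak m$ be the submodule on whose complexification the centre acts through the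 characters $\pm\sqrt{-1}\,\omega_i$, that is, $\mathfrak m_i=\{X\in\mathfrak m:\ (\operatorname{ad}Z_{a,b})^2X=-\omega_i(a,b)^2X\ \text{for all }a,b\in\mathbb R\}$. For $i,j,k\in\{1,\dots,6\}$ the structure constant is $${i \brack j\ k}=\sum_{x,y,z}B\bigl(x,[y,z]\bigr)^2,$$ where $x$, $y$, $z$ run through $(-B)$-orthonormal bases of $\mathfrak m_i$, $\mathfrak m_j$, $\mathfrak m_k$, respectively. Then such bases exist, ${i \brack j\ k}$ does not depend on their choice and is symmetric in $i,j,k$, and with $D=2(n_1+n_2+n_3)-1$ $${1 \brack 3\ 4}=\frac{n_1n_2(n_1-1)}{D},\qquad {2 \brack 3\ 4}=\frac{n_1n_2(n_2-1)}{D},\qquad {3 \brack 5\ 6}={4 \brack 5\ 6}=\frac{n_1n_2(2n_3+1)}{D},$$ $${1 \brack 5\ 5}=\frac{n_1(n_1-1)(2n_3+1)}{D},\qquad {2 \brack 6\ 6}=\frac{n_2(n_2-1)(2n_3+1)}{D},$$ while ${i \brack j\ k}=0$ whenever $(i,j,k)$ is not a permutation of one of these six triples. -/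

import Mathlib

namespace FlagManifold

/-- Indices of the standard basis of `ℝ^(2(n₁+n₂+n₃)+1)`, identified with
`ℂ^n₁ ⊕ ℂ^n₂ ⊕ ℝ^(2n₃+1)`. The second entry of a pair in `Fin n × Fin 2` tells the real
coordinate (`0`) from the imaginary one (`1`). -/
abbrev Idx (n₁ n₂ n₃ : ℕ) : Type :=
  (Fin n₁ × Fin 2) ⊕ ((Fin n₂ × Fin 2) ⊕ Fin (2 * n₃ + 1))

theorem card_idx (n₁ n₂ n₃ : ℕ) :
    Fintype.card (Idx n₁ n₂ n₃) = 2 * (n₁ + n₂ + n₃) + 1 := by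
  simp [Idx]; ring

/-- The Lie algebra `𝔤` of `G = SO(2(n₁+n₂+n₃)+1)`: real skew-symmetric matrices. -/
abbrev G (n₁ n₂ n₃ : ℕ) : Type :=
  LieAlgebra.Orthogonal.so (Idx n₁ n₂ n₃) ℝ

/-- The real `2n × 2n` matrix of a complex `n × n` matrix acting on `ℂ^n = ℝ^(2n)`. -/
def realify {n : ℕ} (A : Matrix (Fin n) (Fin n) ℂ) :
    Matrix (Fin n × Fin 2) (Fin n × Fin 2) ℝ :=
  Matrix.of fun p q =>
    !![(A p.1 q.1).re, -(A p.1 q.1).im; (A p.1 q.1).im, (A p.1 q.1).re] p.2 q.2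

theorem realify_zero {n : ℕ} : realify (0 : Matrix (Fin n) (Fin n) ℂ) = 0 := by
  ext ⟨i, s⟩ ⟨j, t⟩
  fin_cases s <;> fin_cases t <;> simp [realify]

theorem realify_add {n : ℕ} (A B : Matrix (Fin n) (Fin n) ℂ) :
    realify (A + B) = realify A + realify B := by
  ext ⟨i, s⟩ ⟨j, t⟩
  fin_cases s <;> fin_cases t <;> simp [realify] <;> ring

theorem realify_sub {n : ℕ} (A B : Matrix (Fin n) (Fin n) ℂ) :
    realify (A - B) = realify A - realify B := by
  ext ⟨i, s⟩ ⟨j, t⟩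
  fin_cases s <;> fin_cases t <;> simp [realify] <;> ring

theorem realify_smul {n : ℕ} (r : ℝ) (A : Matrix (Fin n) (Fin n) ℂ) :
    realify (r • A) = r • realify A := by
  ext ⟨i, s⟩ ⟨j, t⟩
  fin_cases s <;> fin_cases t <;> simp [realify]

theorem realify_mul {n : ℕ} (A B : Matrix (Fin n) (Fin n) ℂ) :
    realify (A * B) = realify A * realify B := by
  ext ⟨i, s⟩ ⟨j, t⟩
  fin_cases s <;> fin_cases t <;>
    simp [realify, Matrix.mul_apply, Fintype.sum_prod_type, Finset.sum_add_distrib,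
      Finset.sum_sub_distrib, Finset.sum_neg_distrib] <;> ring

theorem realify_transpose {n : ℕ} (A : Matrix (Fin n) (Fin n) ℂ) :
    (realify A).transpose = realify A.conjTranspose := by
  ext ⟨i, s⟩ ⟨j, t⟩
  fin_cases s <;> fin_cases t <;> simp [realify]

/-- The block diagonal matrix with blocks `A`, `B` (complex) and `C` (real). -/
def blockDiag {n₁ n₂ n₃ : ℕ} (A : Matrix (Fin n₁) (Fin n₁) ℂ) (B : Matrix (Fin n₂) (Fin n₂) ℂ)
    (C : Matrix (Fin (2 * n₃ + 1)) (Fin (2 * n₃ + 1)) ℝ) :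
    Matrix (Idx n₁ n₂ n₃) (Idx n₁ n₂ n₃) ℝ :=
  Matrix.fromBlocks (realify A) 0 0 (Matrix.fromBlocks (realify B) 0 0 C)

theorem blockDiag_mem_so {n₁ n₂ n₃ : ℕ} {A : Matrix (Fin n₁) (Fin n₁) ℂ}
    {B : Matrix (Fin n₂) (Fin n₂) ℂ} {C : Matrix (Fin (2 * n₃ + 1)) (Fin (2 * n₃ + 1)) ℝ}
    (hA : A.conjTranspose = -A) (hB : B.conjTranspose = -B) (hC : C.transpose = -C) :
    blockDiag A B C ∈ LieAlgebra.Orthogonal.so (Idx n₁ n₂ n₃) ℝ := by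
  have key : ∀ {n : ℕ} (A : Matrix (Fin n) (Fin n) ℂ), realify (-A) = -realify A := by
    intro n A
    have := realify_smul (-1) A
    simpa using this
  rw [LieAlgebra.Orthogonal.mem_so, blockDiag, Matrix.fromBlocks_transpose,
    Matrix.fromBlocks_transpose, realify_transpose, realify_transpose, hA, hB, hC, key, key,
    Matrix.fromBlocks_neg, Matrix.fromBlocks_neg]
  simp

/-- The Lie algebra `𝔥 = 𝔲(n₁) ⊕ 𝔲(n₂) ⊕ 𝔰𝔬(2n₃+1)` of `H = U(n₁) × U(n₂) × SO(2n₃+1)`,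
embedded in `𝔤` by diagonal blocks. -/
def isotropyAlgebra (n₁ n₂ n₃ : ℕ) : LieSubalgebra ℝ (G n₁ n₂ n₃) where
  carrier := {X | ∃ (A : Matrix (Fin n₁) (Fin n₁) ℂ) (B : Matrix (Fin n₂) (Fin n₂) ℂ)
    (C : Matrix (Fin (2 * n₃ + 1)) (Fin (2 * n₃ + 1)) ℝ),
    A.conjTranspose = -A ∧ B.conjTranspose = -B ∧ C.transpose = -C ∧
      (X : Matrix (Idx n₁ n₂ n₃) (Idx n₁ n₂ n₃) ℝ) = blockDiag A B C}
  zero_mem' := ⟨0, 0, 0, by simp, by simp, by simp, by simp [blockDiag, realify_zero]⟩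
  add_mem' := by
    rintro X Y ⟨A, B, C, hA, hB, hC, hX⟩ ⟨A', B', C', hA', hB', hC', hY⟩
    refine ⟨A + A', B + B', C + C', ?_, ?_, ?_, ?_⟩
    · rw [Matrix.conjTranspose_add, hA, hA']; abel
    · rw [Matrix.conjTranspose_add, hB, hB']; abel
    · rw [Matrix.transpose_add, hC, hC']; abel
    · rw [AddMemClass.coe_add, hX, hY]
      simp [blockDiag, realify_add, Matrix.fromBlocks_add]
  smul_mem' := by
    rintro r X ⟨A, B, C, hA, hB, hC, hX⟩
    refine ⟨r • A, r • B, r • C, ?_, ?_, ?_, ?_⟩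
    · rw [Matrix.conjTranspose_smul, hA]; simp
    · rw [Matrix.conjTranspose_smul, hB]; simp
    · rw [Matrix.transpose_smul, hC]; simp
    · rw [SetLike.val_smul, hX]
      simp [blockDiag, realify_smul, Matrix.fromBlocks_smul]
  lie_mem' := by
    rintro X Y ⟨A, B, C, hA, hB, hC, hX⟩ ⟨A', B', C', hA', hB', hC', hY⟩
    refine ⟨A * A' - A' * A, B * B' - B' * B, C * C' - C' * C, ?_, ?_, ?_, ?_⟩
    · rw [Matrix.conjTranspose_sub, Matrix.conjTranspose_mul, Matrix.conjTranspose_mul, hA, hA']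
      simp
    · rw [Matrix.conjTranspose_sub, Matrix.conjTranspose_mul, Matrix.conjTranspose_mul, hB, hB']
      simp
    · rw [Matrix.transpose_sub, Matrix.transpose_mul, Matrix.transpose_mul, hC, hC']
      simp
    · have hXY : ((⁅X, Y⁆ : G n₁ n₂ n₃) : Matrix (Idx n₁ n₂ n₃) (Idx n₁ n₂ n₃) ℝ) =
          X.1 * Y.1 - Y.1 * X.1 := rfl
      rw [hXY, hX, hY]
      simp only [blockDiag, realify_sub, realify_mul, Matrix.fromBlocks_multiply]
      simp [sub_eq_add_neg, Matrix.fromBlocks_add, Matrix.fromBlocks_neg]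

/-- The isotropy module `𝔪`: the orthogonal complement of `𝔥` for the Killing form of `𝔤`. -/
noncomputable def isotropyModule (n₁ n₂ n₃ : ℕ) : Submodule ℝ (G n₁ n₂ n₃) where
  carrier := {X | ∀ Y ∈ isotropyAlgebra n₁ n₂ n₃, killingForm ℝ (G n₁ n₂ n₃) X Y = 0}
  zero_mem' := by intro Y _; simp
  add_mem' := by intro X X' hX hX' Y hY; simp [hX Y hY, hX' Y hY]
  smul_mem' := by intro r X hX Y hY; simp [hX Y hY]

theorem conjTranspose_scalar {n : ℕ} (a : ℝ) :
    (((a : ℂ) * Complex.I) • (1 : Matrix (Fin n) (Fin n) ℂ)).conjTranspose =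
      -(((a : ℂ) * Complex.I) • (1 : Matrix (Fin n) (Fin n) ℂ)) := by
  rw [Matrix.conjTranspose_smul, Matrix.conjTranspose_one, ← neg_smul]
  simp

/-- The general element `(a i Id, b i Id, 0)` of the centre of
`𝔥 = 𝔲(n₁) ⊕ 𝔲(n₂) ⊕ 𝔰𝔬(2n₃+1)`, that is, of the Lie algebra of the torus `Z(H)`. -/
noncomputable def centralElement (n₁ n₂ n₃ : ℕ) (a b : ℝ) : G n₁ n₂ n₃ :=
  ⟨blockDiag (((a : ℂ) * Complex.I) • 1) (((b : ℂ) * Complex.I) • 1) 0,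
    blockDiag_mem_so (conjTranspose_scalar a) (conjTranspose_scalar b) (by simp)⟩

/-- Labels `1, …, 6` of the positive `T`-roots. -/
inductive Label : Type
  | one | two | three | four | five | six
  deriving DecidableEq

/-- The positive `T`-roots `ω₁, …, ω₆`, of type `BC₂`, as linear functionals of the coordinates
`(a, b)` on the centre of `𝔥`. In terms of the simple `T`-roots `α = a - b` and `β = b` they are
`2α + 2β, 2β, α, α + 2β, α + β, β`. -/
def tRoot : Label → ℝ → ℝ → ℝ
  | .one, a, _ => 2 * a
  | .two, _, b => 2 * b
  | .three, a, b => a - b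
  | .four, a, b => a + b
  | .five, a, _ => a
  | .six, _, b => b

/-- The summand `𝔪ᵢ` of the isotropy module: the part of `𝔪` on whose complexification the
centre of `𝔥` acts through the characters `± √-1 ωᵢ`. In real terms, `(ad Z)²` acts on it as the
scalar `-ωᵢ(Z)²` for every central element `Z`. -/
noncomputable def summand (n₁ n₂ n₃ : ℕ) (i : Label) : Submodule ℝ (G n₁ n₂ n₃) where
  carrier := {X | X ∈ isotropyModule n₁ n₂ n₃ ∧ ∀ a b : ℝ,
    ⁅centralElement n₁ n₂ n₃ a b, ⁅centralElement n₁ n₂ n₃ a b, X⁆⁆ = -((tRoot i a b) ^ 2 • X)}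
  zero_mem' := ⟨Submodule.zero_mem _, by intro a b; simp⟩
  add_mem' := by
    rintro X Y ⟨hX, hX'⟩ ⟨hY, hY'⟩
    refine ⟨Submodule.add_mem _ hX hY, fun a b => ?_⟩
    rw [lie_add, lie_add, hX', hY', smul_add, neg_add]
  smul_mem' := by
    rintro r X ⟨hX, hX'⟩
    refine ⟨Submodule.smul_mem _ r hX, fun a b => ?_⟩
    rw [lie_smul, lie_smul, hX', smul_neg, smul_comm]

/-- `b` is an orthonormal basis of the subspace `V` for the scalar product `-B`, where `B` is the
Killing form of `L`. -/
def IsOrthonormalBasis {L : Type*} [LieRing L] [LieAlgebra ℝ L] {V : Submodule ℝ L} {N : ℕ}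
    (b : Module.Basis (Fin N) ℝ V) : Prop :=
  ∀ s t : Fin N, -killingForm ℝ L (b s : L) (b t : L) = if s = t then 1 else 0

/-- `c` is the structure constant `[U; V W]`: the subspaces have `(-B)`-orthonormal bases, and the
sum of all `B(x, [y, z])²`, with `x`, `y`, `z` running through any such bases of `U`, `V`, `W`,
equals `c`. -/
def IsStructureConstant {L : Type*} [LieRing L] [LieAlgebra ℝ L] (U V W : Submodule ℝ L)
    (c : ℝ) : Prop :=
  (∃ x : Module.Basis (Fin (Module.finrank ℝ U)) ℝ U, IsOrthonormalBasis x) ∧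
  (∃ y : Module.Basis (Fin (Module.finrank ℝ V)) ℝ V, IsOrthonormalBasis y) ∧
  (∃ z : Module.Basis (Fin (Module.finrank ℝ W)) ℝ W, IsOrthonormalBasis z) ∧
  ∀ (x : Module.Basis (Fin (Module.finrank ℝ U)) ℝ U)
    (y : Module.Basis (Fin (Module.finrank ℝ V)) ℝ V)
    (z : Module.Basis (Fin (Module.finrank ℝ W)) ℝ W),
    IsOrthonormalBasis x → IsOrthonormalBasis y → IsOrthonormalBasis z →
    ∑ s, ∑ t, ∑ u, (killingForm ℝ L (x s : L) ⁅(y t : L), (z u : L)⁆) ^ 2 = c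

/-- `c` is the structure constant `[i; j k]` of the flag manifold
`SO(2(n₁+n₂+n₃)+1) / U(n₁) × U(n₂) × SO(2n₃+1)`. -/
def FlagStructureConstant (n₁ n₂ n₃ : ℕ) (i j k : Label) (c : ℝ) : Prop :=
  IsStructureConstant (summand n₁ n₂ n₃ i) (summand n₁ n₂ n₃ j) (summand n₁ n₂ n₃ k) c

end FlagManifold

/-! Write `N = 2(n₁+n₂+n₃)+1`, so that `D = N - 2`. On skew matrices the Killing form is `(N-2)
tr(XY)` (`killingForm_so`), so everything reduces to block matrices.

Let `P_α` be the projector onto a complex block and `J_α` multiplication by `i` on it. Since `Z =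
aJ₁ + bJ₂`, comparing the coefficients of `a²`, `b²` and `ab` in `(ad Z)²X = -ωᵢ²X` describes each
summand by matrix equations (`mem_summand_iff`). The roots `2a`, `2b` give the skew matrices on one
complex block that anticommute with `J_α`; `a ∓ b` give the complex-linear, resp. antilinear, maps
between the two complex blocks; `a`, `b` give everything between one complex block and the real
block.

Vanishing is a weight argument: `B(x,[y,z])` is invariant under `ad Z`, hence zero unless some
signed sum of the three roots vanishes (`killingForm_lie_eq_zero`).

For the nonzero constants fix a unit vector `v` of the first summand. Sums of squares over
orthonormal bases depend only on the spans (`IsNegOrthonormal.sum_sq_eq`), so the other two bases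
may be replaced by normalized matrices `E_pq - E_qp`. Then only brackets sharing the index of the
common block survive, and each returns an entry of `v`; the double sum is the size of that block
times the norm of `v`, up to a factor (`sum_killingForm_lie_skewUnit_sq`). It does not depend on
`v`, so the constant is this number times the dimension of the first summand, which is the trace of
an explicit projector. The spaces for `a - b` and `a + b` separately contain no `E_pq - E_qp`, but
their sum is spanned by such matrices; working with the sum counts the constant twice, because the
two unmixed contributions vanish by weights. -/

namespace FlagManifold

open Matrix

attribute [local instance] LieRing.ofAssociativeRing

/-! ### Traces of the operators M ↦ AMB and M ↦ AMᵀB. -/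

section Sandwich

variable {ι : Type*} [Fintype ι] [DecidableEq ι]

theorem trace_eq_sum_single (f : Matrix ι ι ℝ →ₗ[ℝ] Matrix ι ι ℝ) :
    LinearMap.trace ℝ _ f = ∑ p, ∑ q, f (single p q 1) p q := by
  rw [LinearMap.trace_eq_matrix_trace ℝ (Matrix.stdBasis ℝ ι ι), Matrix.trace,
    Fintype.sum_prod_type]
  refine Finset.sum_congr rfl fun p _ => Finset.sum_congr rfl fun q _ => ?_
  rw [Matrix.diag_apply, LinearMap.toMatrix_apply, Matrix.stdBasis_eq_single]
  rfl

/-- The linear map `M ↦ A M B`. -/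
def sandwich (A B : Matrix ι ι ℝ) : Matrix ι ι ℝ →ₗ[ℝ] Matrix ι ι ℝ :=
  LinearMap.mulLeft ℝ A ∘ₗ LinearMap.mulRight ℝ B

/-- The linear map `M ↦ A Mᵀ B`. -/
def sandwichTranspose (A B : Matrix ι ι ℝ) : Matrix ι ι ℝ →ₗ[ℝ] Matrix ι ι ℝ :=
  sandwich A B ∘ₗ (Matrix.transposeLinearEquiv ι ι ℝ ℝ).toLinearMap

theorem sandwich_apply (A B M : Matrix ι ι ℝ) : sandwich A B M = A * M * B := by
  simp [sandwich, Matrix.mul_assoc]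

theorem sandwichTranspose_apply (A B M : Matrix ι ι ℝ) :
    sandwichTranspose A B M = A * Mᵀ * B := by
  simp [sandwichTranspose, sandwich_apply]

theorem mul_single_mul_apply (A B : Matrix ι ι ℝ) (p q i j : ι) :
    (A * single p q (1 : ℝ) * B) i j = A i p * B q j := by
  rw [Matrix.mul_assoc, Matrix.mul_apply, Finset.sum_eq_single p]
  · simp
  · intro k _ hk
    simp [hk]
  · simp

theorem trace_sandwich (A B : Matrix ι ι ℝ) :
    LinearMap.trace ℝ _ (sandwich A B) = A.trace * B.trace := by
  simp_rw [trace_eq_sum_single, sandwich_apply, mul_single_mul_apply, Matrix.trace,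
    Matrix.diag_apply, Finset.sum_mul_sum]

theorem trace_sandwichTranspose (A B : Matrix ι ι ℝ) :
    LinearMap.trace ℝ _ (sandwichTranspose A B) = (A * Bᵀ).trace := by
  simp_rw [trace_eq_sum_single, sandwichTranspose_apply, Matrix.transpose_single,
    mul_single_mul_apply, Matrix.trace, Matrix.diag_apply, Matrix.mul_apply,
    Matrix.transpose_apply]

end Sandwich

/-! ### The Killing form of the orthogonal Lie algebra. -/

section Killing

variable {ι : Type*} [Fintype ι] [DecidableEq ι]

/-- The projection of square matrices onto skew-symmetric ones. -/
noncomputable def skewPart : Matrix ι ι ℝ →ₗ[ℝ] LieAlgebra.Orthogonal.so ι ℝ :=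
  LinearMap.codRestrict (LieAlgebra.Orthogonal.so ι ℝ).toSubmodule
    ((1 / 2 : ℝ) • (LinearMap.id - (Matrix.transposeLinearEquiv ι ι ℝ ℝ).toLinearMap)) (by
      intro M
      rw [LieSubalgebra.mem_toSubmodule, LieAlgebra.Orthogonal.mem_so]
      simp [Matrix.transpose_sub, ← smul_neg])

theorem coe_skewPart (M : Matrix ι ι ℝ) :
    (skewPart M : Matrix ι ι ℝ) = (1 / 2 : ℝ) • (M - Mᵀ) := rfl

theorem transpose_coe (X : LieAlgebra.Orthogonal.so ι ℝ) :
    (X : Matrix ι ι ℝ)ᵀ = -(X : Matrix ι ι ℝ) :=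
  (LieAlgebra.Orthogonal.mem_so _ _ _).1 X.2

theorem coe_apply_swap (X : LieAlgebra.Orthogonal.so ι ℝ) (p q : ι) :
    (X : Matrix ι ι ℝ) p q = -(X : Matrix ι ι ℝ) q p :=
  congrFun (congrFun (transpose_coe X) q) p

theorem coe_lie (X Y : LieAlgebra.Orthogonal.so ι ℝ) :
    ((⁅X, Y⁆ : LieAlgebra.Orthogonal.so ι ℝ) : Matrix ι ι ℝ) = X.1 * Y.1 - Y.1 * X.1 := rfl

/-- `ad X ∘ ad Y` is the restriction of `T : M ↦ XYM - XMY - YMX + MYX` to skew matrices. By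
cyclicity its trace equals that of `T` composed with the skew projection on all matrices, namely
half of `tr T - tr (T ∘ transpose)`. These two traces are `2N tr(XY)` and `4 tr(XY)`. -/
theorem killingForm_so (X Y : LieAlgebra.Orthogonal.so ι ℝ) :
    killingForm ℝ (LieAlgebra.Orthogonal.so ι ℝ) X Y =
      ((Fintype.card ι : ℝ) - 2) * (X.1 * Y.1).trace := by
  set incl : LieAlgebra.Orthogonal.so ι ℝ →ₗ[ℝ] Matrix ι ι ℝ :=
    (LieAlgebra.Orthogonal.so ι ℝ).toSubmodule.subtype with hincl
  set T : Matrix ι ι ℝ →ₗ[ℝ] Matrix ι ι ℝ :=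
    sandwich (X.1 * Y.1) 1 - sandwich X.1 Y.1 - sandwich Y.1 X.1 + sandwich 1 (Y.1 * X.1) with hT
  have key : LieAlgebra.ad ℝ _ X ∘ₗ LieAlgebra.ad ℝ _ Y = skewPart ∘ₗ (T ∘ₗ incl) := by
    ext1 M
    apply Subtype.ext
    have h : ((LieAlgebra.ad ℝ _ X ∘ₗ LieAlgebra.ad ℝ _ Y) M : Matrix ι ι ℝ) = T M.1 := by
      simp only [LinearMap.comp_apply, LieAlgebra.ad_apply, coe_lie, hT, LinearMap.add_apply,
        LinearMap.sub_apply, sandwich_apply]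
      noncomm_ring
    have h' : (skewPart ((T ∘ₗ incl) M) : Matrix ι ι ℝ) = T M.1 := by
      rw [coe_skewPart, LinearMap.comp_apply, show incl M = M.1 from rfl, ← h, transpose_coe,
        sub_neg_eq_add, ← two_smul ℝ, smul_smul]
      norm_num
    rw [h, LinearMap.comp_apply, h']
  have key2 : (T ∘ₗ incl) ∘ₗ skewPart = (1 / 2 : ℝ) • (T -
      (sandwichTranspose (X.1 * Y.1) 1 - sandwichTranspose X.1 Y.1 - sandwichTranspose Y.1 X.1 +
        sandwichTranspose 1 (Y.1 * X.1))) := by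
    ext1 M
    rw [LinearMap.comp_apply, LinearMap.comp_apply,
      show incl (skewPart M) = (skewPart M).1 from rfl,
      coe_skewPart, map_smul, map_sub]
    rfl
  rw [killingForm_apply_apply, key, LinearMap.trace_comp_comm', key2]
  have h0 (Z : LieAlgebra.Orthogonal.so ι ℝ) : Z.1.trace = 0 := by
    have := congrArg Matrix.trace (transpose_coe Z)
    rw [Matrix.trace_transpose, Matrix.trace_neg] at this
    linarith
  simp only [hT, map_smul, map_sub, map_add, trace_sandwich, trace_sandwichTranspose, h0,
    Matrix.transpose_one, transpose_coe, Matrix.mul_one, Matrix.one_mul, Matrix.trace_one,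
    Matrix.transpose_mul, Matrix.mul_neg, Matrix.neg_mul, neg_neg, Matrix.trace_neg,
    Matrix.trace_mul_comm Y.1 X.1, smul_eq_mul]
  ring

end Killing

/-! ### Orthonormal families for a negative definite form. -/

section Orthonormal

variable {M : Type*} [AddCommGroup M] [Module ℝ M] {ι κ : Type*} [Fintype ι] [Fintype κ]
  [DecidableEq ι] [DecidableEq κ]

/-- `x` is orthonormal for the scalar product `-B`. -/
def IsNegOrthonormal (B : LinearMap.BilinForm ℝ M) (x : ι → M) : Prop :=
  ∀ s t, -B (x s) (x t) = if s = t then 1 else 0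

theorem IsNegOrthonormal.eq_sum {B : LinearMap.BilinForm ℝ M} {y : κ → M}
    (hy : IsNegOrthonormal B y) {v : M} (hv : v ∈ Submodule.span ℝ (Set.range y)) :
    v = ∑ t, (-B v (y t)) • y t := by
  obtain ⟨c, rfl⟩ := (Submodule.mem_span_range_iff_exists_fun ℝ).1 hv
  refine Finset.sum_congr rfl fun t _ => ?_
  congr 1
  have h (s : κ) : -B (c s • y s) (y t) = if s = t then c s else 0 := by
    rw [map_smul, LinearMap.smul_apply, smul_eq_mul, ← mul_neg, hy s t]
    split_ifs <;> simp
  rw [map_sum, LinearMap.sum_apply, ← Finset.sum_neg_distrib]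
  simp_rw [h]
  simp

/-- Two orthonormal families with the same span give the same sum of squares of a functional. -/
theorem IsNegOrthonormal.sum_sq_eq {B : LinearMap.BilinForm ℝ M} (hB : ∀ u v, B u v = B v u)
    {x : ι → M} {y : κ → M} (hx : IsNegOrthonormal B x) (hy : IsNegOrthonormal B y)
    (hxy : ∀ s, x s ∈ Submodule.span ℝ (Set.range y))
    (hyx : ∀ t, y t ∈ Submodule.span ℝ (Set.range x)) (φ : M →ₗ[ℝ] ℝ) :
    ∑ s, φ (x s) ^ 2 = ∑ t, φ (y t) ^ 2 := by
  have h1 (s : ι) : φ (x s) = ∑ t, -B (x s) (y t) * φ (y t) := by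
    conv_lhs => rw [hy.eq_sum (hxy s)]
    simp [map_sum]
  have h2 (t : κ) : φ (y t) = ∑ s, -B (y t) (x s) * φ (x s) := by
    conv_lhs => rw [hx.eq_sum (hyx t)]
    simp [map_sum]
  -- Parseval: expand one factor in the other family, exchange the sums, and recognise the expansion
  -- of `φ (y t)`.
  calc ∑ s, φ (x s) ^ 2 = ∑ s, ∑ t, φ (x s) * (-B (x s) (y t) * φ (y t)) := by
        refine Finset.sum_congr rfl fun s _ => ?_
        rw [← Finset.mul_sum, ← h1, sq]
    _ = ∑ t, φ (y t) * ∑ s, -B (y t) (x s) * φ (x s) := by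
        rw [Finset.sum_comm]
        refine Finset.sum_congr rfl fun t _ => ?_
        rw [Finset.mul_sum]
        refine Finset.sum_congr rfl fun s _ => ?_
        rw [hB (x s)]
        ring
    _ = ∑ t, φ (y t) ^ 2 := by
        refine Finset.sum_congr rfl fun t _ => ?_
        rw [← h2, sq]

theorem exists_negOrthonormal_basis (B : LinearMap.BilinForm ℝ M) (hB : ∀ u v, B u v = B v u)
    (hneg : ∀ u, u ≠ 0 → B u u < 0) (U : Submodule ℝ M) [Module.Finite ℝ U] :
    ∃ x : Module.Basis (Fin (Module.finrank ℝ U)) ℝ U,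
      IsNegOrthonormal B fun s => (x s : M) := by
  let core : InnerProductSpace.Core ℝ U :=
    { inner := fun u v => -B u v
      conj_inner_symm := fun u v => by simp [hB v u]
      re_inner_nonneg := fun u => by
        by_cases hu : (u : M) = 0
        · simp [hu]
        · simpa using (hneg u hu).le
      add_left := fun u v w => by simp; ring
      smul_left := fun u v r => by simp
      definite := fun u hu => by
        by_contra h
        have := hneg u (by simpa using h)
        simp only [neg_eq_zero] at hu
        linarith }
  let _ : NormedAddCommGroup U := core.toNormedAddCommGroup
  let _ : InnerProductSpace ℝ U := InnerProductSpace.ofCore core.toCore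
  refine ⟨(stdOrthonormalBasis ℝ U).toBasis, fun s t => ?_⟩
  have h := orthonormal_iff_ite.1 (stdOrthonormalBasis ℝ U).orthonormal s t
  rw [OrthonormalBasis.coe_toBasis]
  exact h

end Orthonormal

/-! ### Invariance of the Killing form: symmetry and vanishing of structure constants. -/

section Lie

variable {L : Type*} [LieRing L] [LieAlgebra ℝ L]

theorem killingForm_comm (x y : L) : killingForm ℝ L x y = killingForm ℝ L y x :=
  LieModule.traceForm_comm ℝ L L x y

theorem killingForm_lie_left (x y z : L) :
    killingForm ℝ L ⁅x, y⁆ z = killingForm ℝ L x ⁅y, z⁆ :=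
  LieModule.traceForm_apply_lie_apply ℝ L L x y z

theorem killingForm_lie_swap_left (x y z : L) :
    killingForm ℝ L y ⁅x, z⁆ = -killingForm ℝ L x ⁅y, z⁆ := by
  rw [← killingForm_lie_left, ← killingForm_lie_left, ← lie_skew, map_neg, LinearMap.neg_apply]

theorem killingForm_lie_swap_right (x y z : L) :
    killingForm ℝ L x ⁅z, y⁆ = -killingForm ℝ L x ⁅y, z⁆ := by
  rw [← lie_skew, map_neg]

/-- Invariance makes `B(x,[y,z])` totally antisymmetric, so its square is symmetric. This
transposition and the next one generate all permutations. -/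
theorem IsStructureConstant.swap_left {U V W : Submodule ℝ L} {c : ℝ}
    (h : IsStructureConstant U V W c) : IsStructureConstant V U W c := by
  obtain ⟨h1, h2, h3, h4⟩ := h
  refine ⟨h2, h1, h3, fun x y z hx hy hz => ?_⟩
  rw [← h4 y x z hy hx hz, Finset.sum_comm]
  simp only [killingForm_lie_swap_left (_ : L) (x _ : L), neg_sq]

theorem IsStructureConstant.swap_right {U V W : Submodule ℝ L} {c : ℝ}
    (h : IsStructureConstant U V W c) : IsStructureConstant U W V c := by
  obtain ⟨h1, h2, h3, h4⟩ := h
  refine ⟨h1, h3, h2, fun x y z hx hy hz => ?_⟩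
  rw [← h4 x z y hx hz hy]
  refine Finset.sum_congr rfl fun s _ => ?_
  rw [Finset.sum_comm]
  simp only [killingForm_lie_swap_right (_ : L) (z _ : L), neg_sq]

theorem isStructureConstant_of_perm {α : Type*} {F : α → Submodule ℝ L} {c : ℝ} {i j k a b d : α}
    (h : ({i, j, k} : Multiset α) = {a, b, d})
    (hc : IsStructureConstant (F a) (F b) (F d) c) :
    IsStructureConstant (F i) (F j) (F k) c := by
  have hp : List.Perm [i, j, k] [a, b, d] := Multiset.coe_eq_coe.1 h
  have hi : i ∈ [a, b, d] := hp.subset (by simp)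
  have pair {j k b d : α} (hp : List.Perm [j, k] [b, d]) : j = b ∧ k = d ∨ j = d ∧ k = b := by
    have hj : j ∈ [b, d] := hp.subset (by simp)
    simp only [List.mem_cons, List.not_mem_nil, or_false] at hj
    rcases hj with rfl | rfl
    · left
      simpa using hp
    · right
      have := hp.trans (List.Perm.swap _ _ _)
      simpa using this
  simp only [List.mem_cons, List.not_mem_nil, or_false] at hi
  rcases hi with rfl | rfl | rfl
  · rcases pair (List.Perm.cons_inv hp) with ⟨rfl, rfl⟩ | ⟨rfl, rfl⟩
    · exact hc
    · exact hc.swap_right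
  · rcases pair (List.Perm.cons_inv (hp.trans (List.Perm.swap _ _ _))) with ⟨rfl, rfl⟩ | ⟨rfl, rfl⟩
    · exact hc.swap_left
    · exact hc.swap_left.swap_right
  · rcases pair (List.Perm.cons_inv (hp.trans (((List.Perm.swap _ _ _).cons _).trans
      (List.Perm.swap _ _ _)))) with ⟨rfl, rfl⟩ | ⟨rfl, rfl⟩
    · exact hc.swap_right.swap_left
    · exact hc.swap_right.swap_left.swap_right

/-- If `(ad Z)²` acts on `x`, `y`, `z` as `-α²`, `-β²`, `-γ²` and no signed sum of `α`, `β`, `γ`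
vanishes, then `B(x, [y, z]) = 0`. -/
theorem killingForm_lie_eq_zero {Z x y z : L} {α β γ : ℝ}
    (hx : ⁅Z, ⁅Z, x⁆⁆ = -(α ^ 2 • x)) (hy : ⁅Z, ⁅Z, y⁆⁆ = -(β ^ 2 • y))
    (hz : ⁅Z, ⁅Z, z⁆⁆ = -(γ ^ 2 • z))
    (h : (α + β + γ) * (α + β - γ) * (α - β + γ) * (α - β - γ) ≠ 0) :
    killingForm ℝ L x ⁅y, z⁆ = 0 := by
  have inv (u v w : L) : killingForm ℝ L ⁅Z, u⁆ ⁅v, w⁆ + killingForm ℝ L u ⁅⁅Z, v⁆, w⁆ +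
      killingForm ℝ L u ⁅v, ⁅Z, w⁆⁆ = 0 := by
    have h1 := leibniz_lie Z v w
    have h2 : killingForm ℝ L ⁅Z, u⁆ ⁅v, w⁆ = -killingForm ℝ L u ⁅Z, ⁅v, w⁆⁆ := by
      rw [killingForm_lie_left, killingForm_lie_swap_left]
    rw [h2, h1, map_add]
    ring
  -- With `f(x,y,z) = B(x,[y,z])`, the first three relations express `f(Zx,Zy,z)`, `f(Zx,y,Zz)` and
  -- `f(x,Zy,Zz)` through `f(x,y,z)`. Substituting them in the fourth leaves `f(x,y,z)` times
  -- `α⁴+β⁴+γ⁴-2(α²β²+β²γ²+γ²α²)`, which is Heron's product of signed sums.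
  have e1 := inv ⁅Z, x⁆ y z
  have e2 := inv x ⁅Z, y⁆ z
  have e3 := inv x y ⁅Z, z⁆
  have e4 := inv ⁅Z, x⁆ ⁅Z, y⁆ ⁅Z, z⁆
  simp only [hx, hy, hz, map_neg, map_smul, LinearMap.neg_apply, LinearMap.smul_apply, neg_lie,
    lie_neg, smul_lie, lie_smul, smul_eq_mul] at e1 e2 e3 e4
  have : (α + β + γ) * (α + β - γ) * (α - β + γ) * (α - β - γ) * killingForm ℝ L x ⁅y, z⁆ = 0 := by
    linear_combination (β ^ 2 + γ ^ 2 - α ^ 2) * e1 + (α ^ 2 + γ ^ 2 - β ^ 2) * e2 +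
      (α ^ 2 + β ^ 2 - γ ^ 2) * e3 + 2 * e4
  exact (mul_eq_zero.1 this).resolve_left h

end Lie

/-! ### Algebra of the projectors P_α and complex structures J_α. -/

section Blocks

variable {n₁ n₂ n₃ : ℕ}

/-- The block of a basis vector: `some false` for `ℂ^n₁`, `some true` for `ℂ^n₂`, and `none` for
`ℝ^(2n₃+1)`. -/
def blk : Idx n₁ n₂ n₃ → Option Bool :=
  Sum.elim (fun _ => some false) (Sum.elim (fun _ => some true) fun _ => none)

/-- The size of a complex block. -/
def blkSize (n₁ n₂ : ℕ) : Bool → ℕ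
  | false => n₁
  | true => n₂

variable (n₁ n₂ n₃) in
/-- The projector onto a complex block. -/
def idBlk (α : Bool) : Matrix (Idx n₁ n₂ n₃) (Idx n₁ n₂ n₃) ℝ :=
  diagonal fun p => if blk p = some α then 1 else 0

variable (n₁ n₂ n₃) in
/-- Multiplication by `i` on a complex block. -/
def imBlk : Bool → Matrix (Idx n₁ n₂ n₃) (Idx n₁ n₂ n₃) ℝ
  | false => fromBlocks (realify (Complex.I • 1)) 0 0 0
  | true => fromBlocks 0 0 0 (fromBlocks (realify (Complex.I • 1)) 0 0 0)

theorem realify_one {n : ℕ} : realify (1 : Matrix (Fin n) (Fin n) ℂ) = 1 := by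
  ext ⟨i, s⟩ ⟨j, t⟩
  by_cases h : i = j <;> fin_cases s <;> fin_cases t <;> simp [realify, one_apply, h]

theorem realify_I_mul_self {n : ℕ} :
    realify (Complex.I • (1 : Matrix (Fin n) (Fin n) ℂ)) * realify (Complex.I • 1) = -1 := by
  rw [← realify_mul]
  have : (Complex.I • (1 : Matrix (Fin n) (Fin n) ℂ)) * (Complex.I • 1) = (-1 : ℝ) • 1 := by
    simp [smul_smul]
  rw [this, realify_smul, realify_one]
  simp

theorem realify_I_transpose {n : ℕ} :
    (realify (Complex.I • (1 : Matrix (Fin n) (Fin n) ℂ)))ᵀ = -realify (Complex.I • 1) := by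
  rw [realify_transpose]
  have : (Complex.I • (1 : Matrix (Fin n) (Fin n) ℂ))ᴴ = (-1 : ℝ) • (Complex.I • 1) := by
    simp [conjTranspose_smul]
  rw [this, realify_smul]
  simp

theorem idBlk_false :
    idBlk n₁ n₂ n₃ false = fromBlocks (1 : Matrix (Fin n₁ × Fin 2) (Fin n₁ × Fin 2) ℝ) 0 0 0 := by
  ext (p | p | p) (q | q | q) <;> simp [idBlk, blk, diagonal, one_apply]

theorem idBlk_true :
    idBlk n₁ n₂ n₃ true = fromBlocks 0 0 0
      (fromBlocks (1 : Matrix (Fin n₂ × Fin 2) (Fin n₂ × Fin 2) ℝ) 0 0 0) := by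
  ext (p | p | p) (q | q | q) <;> simp [idBlk, blk, diagonal, one_apply]

theorem idBlk_mul_apply (α : Bool) (M : Matrix (Idx n₁ n₂ n₃) (Idx n₁ n₂ n₃) ℝ)
    (p q : Idx n₁ n₂ n₃) : (idBlk n₁ n₂ n₃ α * M) p q = if blk p = some α then M p q else 0 := by
  simp [idBlk, diagonal_mul]

theorem mul_idBlk_apply (α : Bool) (M : Matrix (Idx n₁ n₂ n₃) (Idx n₁ n₂ n₃) ℝ)
    (p q : Idx n₁ n₂ n₃) : (M * idBlk n₁ n₂ n₃ α) p q = if blk q = some α then M p q else 0 := by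
  simp [idBlk, mul_diagonal]

theorem idBlk_mul_idBlk (α β : Bool) :
    idBlk n₁ n₂ n₃ α * idBlk n₁ n₂ n₃ β = if α = β then idBlk n₁ n₂ n₃ α else 0 := by
  cases α <;> cases β <;> simp [idBlk_false, idBlk_true, fromBlocks_multiply, fromBlocks_zero]

theorem idBlk_mul_imBlk (α β : Bool) :
    idBlk n₁ n₂ n₃ α * imBlk n₁ n₂ n₃ β = if α = β then imBlk n₁ n₂ n₃ α else 0 := by
  cases α <;> cases β <;>
    simp [idBlk_false, idBlk_true, imBlk, fromBlocks_multiply, fromBlocks_zero]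

theorem imBlk_mul_idBlk (α β : Bool) :
    imBlk n₁ n₂ n₃ α * idBlk n₁ n₂ n₃ β = if α = β then imBlk n₁ n₂ n₃ α else 0 := by
  cases α <;> cases β <;>
    simp [idBlk_false, idBlk_true, imBlk, fromBlocks_multiply, fromBlocks_zero]

theorem imBlk_mul_imBlk (α β : Bool) :
    imBlk n₁ n₂ n₃ α * imBlk n₁ n₂ n₃ β = if α = β then -idBlk n₁ n₂ n₃ α else 0 := by
  cases α <;> cases β <;>
    simp [idBlk_false, idBlk_true, imBlk, fromBlocks_multiply, fromBlocks_zero, fromBlocks_neg,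
      realify_I_mul_self]

theorem idBlk_transpose (α : Bool) : (idBlk n₁ n₂ n₃ α)ᵀ = idBlk n₁ n₂ n₃ α := by
  simp [idBlk]

theorem imBlk_transpose (α : Bool) : (imBlk n₁ n₂ n₃ α)ᵀ = -imBlk n₁ n₂ n₃ α := by
  cases α <;> simp [imBlk, fromBlocks_transpose, fromBlocks_neg, realify_I_transpose]

theorem idBlk_mul_idBlk_mul (α β : Bool) (M : Matrix (Idx n₁ n₂ n₃) (Idx n₁ n₂ n₃) ℝ) :
    idBlk n₁ n₂ n₃ α * (idBlk n₁ n₂ n₃ β * M) = if α = β then idBlk n₁ n₂ n₃ α * M else 0 := by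
  rw [← Matrix.mul_assoc, idBlk_mul_idBlk]; split_ifs <;> simp

theorem idBlk_mul_imBlk_mul (α β : Bool) (M : Matrix (Idx n₁ n₂ n₃) (Idx n₁ n₂ n₃) ℝ) :
    idBlk n₁ n₂ n₃ α * (imBlk n₁ n₂ n₃ β * M) = if α = β then imBlk n₁ n₂ n₃ α * M else 0 := by
  rw [← Matrix.mul_assoc, idBlk_mul_imBlk]; split_ifs <;> simp

theorem imBlk_mul_idBlk_mul (α β : Bool) (M : Matrix (Idx n₁ n₂ n₃) (Idx n₁ n₂ n₃) ℝ) :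
    imBlk n₁ n₂ n₃ α * (idBlk n₁ n₂ n₃ β * M) = if α = β then imBlk n₁ n₂ n₃ α * M else 0 := by
  rw [← Matrix.mul_assoc, imBlk_mul_idBlk]; split_ifs <;> simp

theorem imBlk_mul_imBlk_mul (α β : Bool) (M : Matrix (Idx n₁ n₂ n₃) (Idx n₁ n₂ n₃) ℝ) :
    imBlk n₁ n₂ n₃ α * (imBlk n₁ n₂ n₃ β * M) =
      if α = β then -(idBlk n₁ n₂ n₃ α * M) else 0 := by
  rw [← Matrix.mul_assoc, imBlk_mul_imBlk]; split_ifs <;> simp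

theorem trace_idBlk (α : Bool) : (idBlk n₁ n₂ n₃ α).trace = 2 * (blkSize n₁ n₂ α : ℝ) := by
  cases α <;> simp [idBlk, blk, blkSize, mul_comm]

theorem trace_imBlk (α : Bool) : (imBlk n₁ n₂ n₃ α).trace = 0 := by
  have := congrArg Matrix.trace (imBlk_transpose (n₁ := n₁) (n₂ := n₂) (n₃ := n₃) α)
  rw [Matrix.trace_transpose, Matrix.trace_neg] at this
  linarith

theorem coe_centralElement (a b : ℝ) : (centralElement n₁ n₂ n₃ a b).1 =
    a • imBlk n₁ n₂ n₃ false + b • imBlk n₁ n₂ n₃ true := by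
  have h {n : ℕ} (c : ℝ) : realify (((c : ℂ) * Complex.I) • (1 : Matrix (Fin n) (Fin n) ℂ)) =
      c • realify (Complex.I • 1) := by
    rw [← realify_smul, mul_smul]
    rfl
  simp [centralElement, blockDiag, imBlk, fromBlocks_smul, fromBlocks_add, h]

end Blocks

/-! ### Matrix equations for the isotropy summands. -/

section Summands

variable {n₁ n₂ n₃ : ℕ}

/-- The coefficients of `a²` (for `false`) and `b²` (for `true`) in `ωᵢ²`. -/
def sqCoeff : Label → Bool → ℝ
  | .one, false => 4
  | .one, true => 0
  | .two, false => 0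
  | .two, true => 4
  | .three, _ => 1
  | .four, _ => 1
  | .five, false => 1
  | .five, true => 0
  | .six, false => 0
  | .six, true => 1

/-- The coefficient of `2ab` in `ωᵢ²`. -/
def crossCoeff : Label → ℝ
  | .three => -1
  | .four => 1
  | _ => 0

theorem tRoot_sq (i : Label) (a b : ℝ) :
    tRoot i a b ^ 2 = a ^ 2 * sqCoeff i false + b ^ 2 * sqCoeff i true +
      2 * a * b * crossCoeff i := by
  cases i <;> simp [tRoot, sqCoeff, crossCoeff] <;> ring

/-- Expand `Z²X - 2ZXZ + XZ²` with `Z = aJ₁ + bJ₂`, `J_α² = -P_α` and `J₁J₂ = J₂J₁ = 0`. -/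
theorem coe_lie_lie_centralElement (a b : ℝ) (X : G n₁ n₂ n₃) :
    (⁅centralElement n₁ n₂ n₃ a b, ⁅centralElement n₁ n₂ n₃ a b, X⁆⁆ : G n₁ n₂ n₃).1 =
      -(a ^ 2 • (idBlk n₁ n₂ n₃ false * X.1 + X.1 * idBlk n₁ n₂ n₃ false +
          (2 : ℝ) • (imBlk n₁ n₂ n₃ false * X.1 * imBlk n₁ n₂ n₃ false)) +
        b ^ 2 • (idBlk n₁ n₂ n₃ true * X.1 + X.1 * idBlk n₁ n₂ n₃ true +
          (2 : ℝ) • (imBlk n₁ n₂ n₃ true * X.1 * imBlk n₁ n₂ n₃ true)) +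
        (2 * a * b) • (imBlk n₁ n₂ n₃ false * X.1 * imBlk n₁ n₂ n₃ true +
          imBlk n₁ n₂ n₃ true * X.1 * imBlk n₁ n₂ n₃ false)) := by
  simp only [coe_lie, coe_centralElement, Matrix.add_mul, Matrix.mul_add, Matrix.sub_mul,
    Matrix.mul_sub, Matrix.smul_mul, Matrix.mul_smul, Matrix.mul_assoc, imBlk_mul_imBlk,
    imBlk_mul_imBlk_mul, Bool.false_eq_true, Bool.true_eq_false, if_true, if_false, Matrix.mul_neg,
    Matrix.mul_zero]
  module

theorem lie_centralElement_of_mem_isotropyAlgebra (a b : ℝ) {Y : G n₁ n₂ n₃}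
    (hY : Y ∈ isotropyAlgebra n₁ n₂ n₃) : ⁅centralElement n₁ n₂ n₃ a b, Y⁆ = 0 := by
  obtain ⟨A, B, C, -, -, -, h⟩ := hY
  apply Subtype.ext
  rw [coe_lie, h]
  simp [centralElement, blockDiag, fromBlocks_multiply, ← realify_mul]

/-- `Z` commutes with `𝔥`, so moving `ad Z` across the form kills `B([Z,[Z,X]], Y)`. Thus membership
in `𝔪` follows from a nonzero eigenvalue. -/
theorem mem_isotropyModule_of_lie_lie {a b c : ℝ} (hc : c ≠ 0) {X : G n₁ n₂ n₃}
    (hX : ⁅centralElement n₁ n₂ n₃ a b, ⁅centralElement n₁ n₂ n₃ a b, X⁆⁆ = -(c • X)) :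
    X ∈ isotropyModule n₁ n₂ n₃ := by
  intro Y hY
  have h : killingForm ℝ (G n₁ n₂ n₃)
      ⁅centralElement n₁ n₂ n₃ a b, ⁅centralElement n₁ n₂ n₃ a b, X⁆⁆ Y = 0 := by
    rw [killingForm_lie_left, killingForm_lie_swap_left,
      lie_centralElement_of_mem_isotropyAlgebra a b hY]
    simp
  rw [hX, map_neg, map_smul, LinearMap.neg_apply, LinearMap.smul_apply, smul_eq_mul, neg_eq_zero]
    at h
  exact (mul_eq_zero.1 h).resolve_left hc

theorem mem_summand_iff (i : Label) (X : G n₁ n₂ n₃) :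
    X ∈ summand n₁ n₂ n₃ i ↔
      (∀ α, idBlk n₁ n₂ n₃ α * X.1 + X.1 * idBlk n₁ n₂ n₃ α +
        (2 : ℝ) • (imBlk n₁ n₂ n₃ α * X.1 * imBlk n₁ n₂ n₃ α) = sqCoeff i α • X.1) ∧
      imBlk n₁ n₂ n₃ false * X.1 * imBlk n₁ n₂ n₃ true +
        imBlk n₁ n₂ n₃ true * X.1 * imBlk n₁ n₂ n₃ false = crossCoeff i • X.1 := by
  constructor
  · rintro ⟨-, h⟩
    have h' (a b : ℝ) := congrArg Subtype.val (h a b)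
    simp only [coe_lie_lie_centralElement, tRoot_sq] at h'
    have h10 := h' 1 0
    have h01 := h' 0 1
    have h11 := h' 1 1
    simp only [NegMemClass.coe_neg, SetLike.val_smul, neg_inj] at h10 h01 h11
    simp only [one_pow, ne_eq, OfNat.ofNat_ne_zero, not_false_eq_true, zero_pow, one_smul,
      zero_smul, mul_zero, zero_mul, mul_one, one_mul, add_zero, zero_add] at h10 h01 h11
    refine ⟨fun α => ?_, ?_⟩
    · cases α
      · exact h10
      · exact h01
    · rw [h10, h01, add_smul, add_smul, add_right_inj, mul_smul] at h11
      exact smul_right_injective _ two_ne_zero h11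
  · rintro ⟨h1, h2⟩
    have key (a b : ℝ) : ⁅centralElement n₁ n₂ n₃ a b, ⁅centralElement n₁ n₂ n₃ a b, X⁆⁆ =
        -((tRoot i a b) ^ 2 • X) := by
      apply Subtype.ext
      rw [coe_lie_lie_centralElement, h1, h1, h2, tRoot_sq, NegMemClass.coe_neg, SetLike.val_smul]
      module
    -- At `(2,1)` the six roots take the nonzero values 4, 2, 1, 3, 2, 1.
    refine ⟨mem_isotropyModule_of_lie_lie (a := 2) (b := 1) ?_ (key 2 1), key⟩
    cases i <;> norm_num [tRoot]

end Summands

/-! ### The three types of summands: long, mixed and short roots. -/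

section Membership

variable {n₁ n₂ n₃ : ℕ}

/-- The label of the `T`-root `2a` or `2b`. -/
def longLabel : Bool → Label
  | false => .one
  | true => .two

/-- The label of the `T`-root `a - b` (for `false`) or `a + b` (for `true`). -/
def mixedLabel : Bool → Label
  | false => .three
  | true => .four

/-- The label of the `T`-root `a` or `b`. -/
def shortLabel : Bool → Label
  | false => .five
  | true => .six

/-- The second equation says that `X` anticommutes with `J_α`, because `J_α² = -P_α`. Compressing
`PX + XP + 2JXJ = 4X` on both sides by `P` gives `JXJ = PXP`; compressing on one side then gives `PX
= PXP = XP`, hence `X = PXP`. -/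
theorem mem_summand_longLabel_iff (α : Bool) (X : G n₁ n₂ n₃) :
    X ∈ summand n₁ n₂ n₃ (longLabel α) ↔
      idBlk n₁ n₂ n₃ α * X.1 * idBlk n₁ n₂ n₃ α = X.1 ∧
      imBlk n₁ n₂ n₃ α * X.1 * imBlk n₁ n₂ n₃ α = X.1 := by
  rw [mem_summand_iff]
  constructor
  · rintro ⟨h, -⟩
    have h0 := h α
    rw [show sqCoeff (longLabel α) α = 4 by cases α <;> rfl] at h0
    have hL := congrArg (idBlk n₁ n₂ n₃ α * ·) h0
    have hR := congrArg (· * idBlk n₁ n₂ n₃ α) h0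
    have hLR := congrArg (fun M => idBlk n₁ n₂ n₃ α * (M * idBlk n₁ n₂ n₃ α)) h0
    simp only [Matrix.mul_add, Matrix.add_mul, Matrix.mul_smul, Matrix.smul_mul, Matrix.mul_assoc,
      idBlk_mul_idBlk, imBlk_mul_idBlk, idBlk_mul_idBlk_mul, idBlk_mul_imBlk_mul,
      if_true] at h0 hL hR hLR ⊢
    simp only [← Matrix.ext_iff, Matrix.add_apply, Matrix.smul_apply, smul_eq_mul] at h0 hL hR hLR ⊢
    constructor <;> intro p q <;> linarith [h0 p q, hL p q, hR p q, hLR p q]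
  · rintro ⟨h1, h2⟩
    constructor
    · intro β
      rw [← h1]
      have h3 : imBlk n₁ n₂ n₃ α * X.1 * imBlk n₁ n₂ n₃ α =
        idBlk n₁ n₂ n₃ α * X.1 * idBlk n₁ n₂ n₃ α := by rw [h1, h2]
      simp only [Matrix.mul_assoc] at h3
      cases α <;> cases β <;>
        simp [Matrix.mul_assoc, idBlk_mul_idBlk, idBlk_mul_imBlk,
          idBlk_mul_idBlk_mul, imBlk_mul_idBlk_mul, h3, sqCoeff, longLabel] <;> module
    · rw [← h1]
      cases α <;> simp [Matrix.mul_assoc, idBlk_mul_imBlk, imBlk_mul_idBlk_mul, crossCoeff,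
        longLabel]

theorem crossCoeff_mixedLabel_mul_self (ε : Bool) :
    crossCoeff (mixedLabel ε) * crossCoeff (mixedLabel ε) = 1 := by
  cases ε <;> simp [crossCoeff, mixedLabel]

/-- The cross equation alone suffices: since `P_α` absorbs `J_α`, it already forces `X` into the two
blocks joining `ℂ^n₁` and `ℂ^n₂`, where the other equations hold. -/
theorem mem_summand_mixedLabel_iff (ε : Bool) (X : G n₁ n₂ n₃) :
    X ∈ summand n₁ n₂ n₃ (mixedLabel ε) ↔
      imBlk n₁ n₂ n₃ false * X.1 * imBlk n₁ n₂ n₃ true +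
        imBlk n₁ n₂ n₃ true * X.1 * imBlk n₁ n₂ n₃ false = crossCoeff (mixedLabel ε) • X.1 := by
  rw [mem_summand_iff]
  refine ⟨fun h => h.2, fun h => ⟨fun α => ?_, h⟩⟩
  rw [show sqCoeff (mixedLabel ε) α = 1 by cases ε <;> rfl, one_smul]
  have hX : X.1 = crossCoeff (mixedLabel ε) • (imBlk n₁ n₂ n₃ false * X.1 * imBlk n₁ n₂ n₃ true +
        imBlk n₁ n₂ n₃ true * X.1 * imBlk n₁ n₂ n₃ false) := by
    rw [h, smul_smul, crossCoeff_mixedLabel_mul_self, one_smul]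
  rw [hX]
  cases α <;> simp [Matrix.mul_add, Matrix.add_mul, Matrix.mul_assoc, idBlk_mul_imBlk_mul,
    imBlk_mul_idBlk, imBlk_mul_imBlk, imBlk_mul_imBlk_mul, add_comm]

theorem eq_of_mem_summand_mixedLabel {ε : Bool} {X : G n₁ n₂ n₃}
    (hX : X ∈ summand n₁ n₂ n₃ (mixedLabel ε)) :
    X.1 = idBlk n₁ n₂ n₃ false * X.1 * idBlk n₁ n₂ n₃ true +
      idBlk n₁ n₂ n₃ true * X.1 * idBlk n₁ n₂ n₃ false := by
  have h : X.1 = crossCoeff (mixedLabel ε) • (imBlk n₁ n₂ n₃ false * X.1 *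
      imBlk n₁ n₂ n₃ true + imBlk n₁ n₂ n₃ true * X.1 * imBlk n₁ n₂ n₃ false) := by
    rw [(mem_summand_mixedLabel_iff ε X).1 hX, smul_smul, crossCoeff_mixedLabel_mul_self, one_smul]
  rw [h]
  simp [Matrix.mul_add, Matrix.mul_assoc, idBlk_mul_imBlk_mul, imBlk_mul_idBlk]

theorem mem_summand_shortLabel_iff (α : Bool) (X : G n₁ n₂ n₃) :
    X ∈ summand n₁ n₂ n₃ (shortLabel α) ↔
      ∀ p q, X.1 p q ≠ 0 →
        blk p = some α ∧ blk q = none ∨ blk p = none ∧ blk q = some α := by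
  rw [mem_summand_iff]
  constructor
  · rintro ⟨h, -⟩
    have h0 := h α
    have h1 := h (!α)
    rw [show sqCoeff (shortLabel α) α = 1 by cases α <;> rfl, one_smul] at h0
    rw [show sqCoeff (shortLabel α) (!α) = 0 by cases α <;> rfl, zero_smul] at h1
    -- Sandwiching by `P_α` gives `PXP + 2JXJ = 0` and sandwiching by `J_α` gives `JXJ + 2PXP = 0`,
    -- so both vanish and `X = PX + XP`: exactly one index of each nonzero entry lies in block `α`.
    -- The equation of the opposite block then rules out that block for the other index.
    have hLR := congrArg (fun M => idBlk n₁ n₂ n₃ α * (M * idBlk n₁ n₂ n₃ α)) h0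
    have hJ := congrArg (fun M => imBlk n₁ n₂ n₃ α * (M * imBlk n₁ n₂ n₃ α)) h0
    have hL1 := congrArg (fun M => idBlk n₁ n₂ n₃ (!α) * M) h1
    have hR1 := congrArg (fun M => M * idBlk n₁ n₂ n₃ (!α)) h1
    have hLR1 := congrArg (fun M => idBlk n₁ n₂ n₃ (!α) * (M * idBlk n₁ n₂ n₃ (!α))) h1
    simp only [Matrix.mul_add, Matrix.add_mul, Matrix.mul_smul, Matrix.smul_mul, Matrix.mul_assoc,
      idBlk_mul_idBlk, idBlk_mul_imBlk, imBlk_mul_idBlk, imBlk_mul_imBlk, idBlk_mul_idBlk_mul,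
      idBlk_mul_imBlk_mul, imBlk_mul_idBlk_mul, imBlk_mul_imBlk_mul, Matrix.mul_neg,
      if_true] at h0 hLR hJ h1 hL1 hR1 hLR1
    simp only [← Matrix.ext_iff, Matrix.add_apply, Matrix.smul_apply, smul_eq_mul,
      Matrix.neg_apply, Matrix.mul_zero, Matrix.zero_mul, Matrix.zero_apply]
      at h0 hLR hJ h1 hL1 hR1 hLR1
    intro p q hpq
    have e0 := h0 p q
    have e1 := hLR p q
    have e2 := hJ p q
    have e3 := hL1 p q
    have e4 := hR1 p q
    have e5 := hLR1 p q
    have e6 := h1 p q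
    have d1 : (idBlk n₁ n₂ n₃ α * (X.1 * idBlk n₁ n₂ n₃ α)) p q =
      if blk p = some α then if blk q = some α then X.1 p q else 0 else 0 := by
      rw [idBlk_mul_apply, mul_idBlk_apply]
    have d2 : (idBlk n₁ n₂ n₃ (!α) * (X.1 * idBlk n₁ n₂ n₃ (!α))) p q =
      if blk p = some (!α) then if blk q = some (!α) then X.1 p q else 0 else 0 := by
      rw [idBlk_mul_apply, mul_idBlk_apply]
    simp only [d1, d2, idBlk_mul_apply, mul_idBlk_apply] at e0 e1 e2 e3 e4 e5 e6
    by_contra hcon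
    apply hpq
    generalize blk p = bp at *
    generalize blk q = bq at *
    rcases bp with _ | bp <;> rcases bq with _ | bq
    all_goals
      cases α
      all_goals try cases bp
      all_goals try cases bq
      all_goals simp at e0 e1 e2 e3 e4 e5 e6 hcon
      all_goals linarith
  · intro h
    have hX : X.1 = idBlk n₁ n₂ n₃ α * X.1 + X.1 * idBlk n₁ n₂ n₃ α := by
      ext p q
      rw [Matrix.add_apply, idBlk_mul_apply, mul_idBlk_apply]
      by_cases h0 : X.1 p q = 0
      · simp [h0]
      · rcases h p q h0 with ⟨hp, hq⟩ | ⟨hp, hq⟩ <;> simp [hp, hq]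
    have hX' : idBlk n₁ n₂ n₃ α * X.1 * idBlk n₁ n₂ n₃ α = 0 := by
      ext p q
      rw [mul_idBlk_apply, idBlk_mul_apply, Matrix.zero_apply]
      by_cases h0 : X.1 p q = 0
      · simp [h0]
      · rcases h p q h0 with ⟨hp, hq⟩ | ⟨hp, hq⟩ <;> simp [hp, hq]
    have hXβ : idBlk n₁ n₂ n₃ (!α) * X.1 = 0 := by
      ext p q
      rw [idBlk_mul_apply, Matrix.zero_apply]
      by_cases h0 : X.1 p q = 0
      · simp [h0]
      · rcases h p q h0 with ⟨hp, hq⟩ | ⟨hp, hq⟩ <;> simp [hp]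
    have hXβ' : X.1 * idBlk n₁ n₂ n₃ (!α) = 0 := by
      ext p q
      rw [mul_idBlk_apply, Matrix.zero_apply]
      by_cases h0 : X.1 p q = 0
      · simp [h0]
      · rcases h p q h0 with ⟨hp, hq⟩ | ⟨hp, hq⟩ <;> simp [hq]
    have im_left (β : Bool) : imBlk n₁ n₂ n₃ β = imBlk n₁ n₂ n₃ β * idBlk n₁ n₂ n₃ β := by
      simp [imBlk_mul_idBlk]
    have im_right (β : Bool) : imBlk n₁ n₂ n₃ β = idBlk n₁ n₂ n₃ β * imBlk n₁ n₂ n₃ β := by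
      simp [idBlk_mul_imBlk]
    have hJ (β γ : Bool) (h0 : idBlk n₁ n₂ n₃ β * X.1 * idBlk n₁ n₂ n₃ γ = 0) :
        imBlk n₁ n₂ n₃ β * X.1 * imBlk n₁ n₂ n₃ γ = 0 := by
      rw [im_left β, im_right γ]
      calc _ = imBlk n₁ n₂ n₃ β * (idBlk n₁ n₂ n₃ β * X.1 * idBlk n₁ n₂ n₃ γ) *
            imBlk n₁ n₂ n₃ γ := by simp only [Matrix.mul_assoc]
        _ = 0 := by rw [h0]; simp
    have hα := hJ α α hX'
    have hβ := hJ (!α) (!α) (by rw [hXβ, Matrix.zero_mul])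
    have hαβ := hJ α (!α) (by rw [Matrix.mul_assoc, hXβ', Matrix.mul_zero])
    have hβα := hJ (!α) α (by rw [hXβ, Matrix.zero_mul])
    refine ⟨fun β => ?_, ?_⟩
    · rcases Bool.eq_or_eq_not β α with rfl | rfl
      · rw [hα, smul_zero, add_zero, ← hX]
        cases β <;> simp [sqCoeff, shortLabel]
      · rw [hβ, hXβ, hXβ']
        cases α <;> simp [sqCoeff, shortLabel]
    · cases α <;> simp only [Bool.not_false, Bool.not_true] at hαβ hβα <;>
        simp [hαβ, hβα, crossCoeff, shortLabel]

end Membership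

/-! ### Dimensions of the long and mixed summands as traces of projectors. -/

section Dimensions

variable {n₁ n₂ n₃ : ℕ}

theorem finrank_summand_of_isProj {i : Label}
    {f : Matrix (Idx n₁ n₂ n₃) (Idx n₁ n₂ n₃) ℝ →ₗ[ℝ] Matrix (Idx n₁ n₂ n₃) (Idx n₁ n₂ n₃) ℝ}
    (hf : ∀ M, ∃ X ∈ summand n₁ n₂ n₃ i, f M = X.1) (hf' : ∀ X ∈ summand n₁ n₂ n₃ i, f X.1 = X.1) :
    (Module.finrank ℝ (summand n₁ n₂ n₃ i) : ℝ) = LinearMap.trace ℝ _ f := by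
  have hp : LinearMap.IsProj ((summand n₁ n₂ n₃ i).map
      (LieAlgebra.Orthogonal.so (Idx n₁ n₂ n₃) ℝ).toSubmodule.subtype) f := by
    constructor
    · intro M
      obtain ⟨X, hX, h⟩ := hf M
      exact ⟨X, hX, h.symm⟩
    · rintro _ ⟨X, hX, rfl⟩
      exact hf' X hX
  rw [hp.trace]
  congr 1
  exact (LinearEquiv.finrank_eq (Submodule.equivMapOfInjective _
    (LieAlgebra.Orthogonal.so (Idx n₁ n₂ n₃) ℝ).toSubmodule.injective_subtype _))

theorem finrank_summand_longLabel (α : Bool) :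
    (Module.finrank ℝ (summand n₁ n₂ n₃ (longLabel α)) : ℝ) =
      blkSize n₁ n₂ α * (blkSize n₁ n₂ α - 1) := by
  -- The projector restricts to the block and averages over the commuting involutions `M ↦ -Mᵀ` and
  -- `M ↦ JMJ`. With `n` the complex size of the block, its trace is `((2n)² - 2n + 0 - 2n)/4`.
  rw [finrank_summand_of_isProj (f := (1 / 4 : ℝ) •
    (sandwich (idBlk n₁ n₂ n₃ α) (idBlk n₁ n₂ n₃ α) -
      sandwichTranspose (idBlk n₁ n₂ n₃ α) (idBlk n₁ n₂ n₃ α) +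
      sandwich (imBlk n₁ n₂ n₃ α) (imBlk n₁ n₂ n₃ α) -
      sandwichTranspose (imBlk n₁ n₂ n₃ α) (imBlk n₁ n₂ n₃ α)))]
  · simp only [map_smul, map_sub, map_add, trace_sandwich, trace_sandwichTranspose,
      idBlk_transpose, imBlk_transpose, Matrix.mul_neg, idBlk_mul_idBlk, imBlk_mul_imBlk, if_true,
      trace_idBlk, trace_imBlk, neg_neg, smul_eq_mul]
    ring
  · intro M
    refine ⟨⟨_, ?_⟩, ?_, rfl⟩
    · rw [LieAlgebra.Orthogonal.mem_so]
      simp only [LinearMap.smul_apply, LinearMap.sub_apply, LinearMap.add_apply, sandwich_apply,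
        sandwichTranspose_apply, Matrix.transpose_smul, Matrix.transpose_sub, Matrix.transpose_add,
        Matrix.transpose_mul, idBlk_transpose, imBlk_transpose, Matrix.transpose_transpose,
        Matrix.mul_neg, Matrix.neg_mul, neg_neg, Matrix.mul_assoc]
      module
    · rw [mem_summand_longLabel_iff]
      simp only [LinearMap.smul_apply, LinearMap.sub_apply, LinearMap.add_apply, sandwich_apply,
        sandwichTranspose_apply, Matrix.mul_smul, Matrix.smul_mul, Matrix.mul_add, Matrix.add_mul,
        Matrix.mul_sub, Matrix.sub_mul, Matrix.mul_assoc, idBlk_mul_idBlk, idBlk_mul_imBlk,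
        imBlk_mul_idBlk, imBlk_mul_imBlk, idBlk_mul_idBlk_mul, idBlk_mul_imBlk_mul,
        imBlk_mul_idBlk_mul, imBlk_mul_imBlk_mul, if_true, Matrix.mul_neg, Matrix.neg_mul, neg_neg,
        true_and]
      module
  · intro X hX
    obtain ⟨h1, h2⟩ := (mem_summand_longLabel_iff α X).1 hX
    simp only [LinearMap.smul_apply, LinearMap.sub_apply, LinearMap.add_apply, sandwich_apply,
      sandwichTranspose_apply, transpose_coe, Matrix.mul_neg, Matrix.neg_mul, h1, h2]
    module

theorem finrank_summand_mixedLabel (ε : Bool) :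
    (Module.finrank ℝ (summand n₁ n₂ n₃ (mixedLabel ε)) : ℝ) = 2 * n₁ * n₂ := by
  -- The same averaging on the two off-diagonal blocks, with `M ↦ ±(J₁MJ₂ + J₂MJ₁)` as second
  -- involution. Only the first two terms have nonzero trace, `2n₁ · 2n₂` each.
  rw [finrank_summand_of_isProj (f := (1 / 4 : ℝ) •
    (sandwich (idBlk n₁ n₂ n₃ false) (idBlk n₁ n₂ n₃ true) +
      sandwich (idBlk n₁ n₂ n₃ true) (idBlk n₁ n₂ n₃ false) -
      sandwichTranspose (idBlk n₁ n₂ n₃ false) (idBlk n₁ n₂ n₃ true) -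
      sandwichTranspose (idBlk n₁ n₂ n₃ true) (idBlk n₁ n₂ n₃ false) +
      crossCoeff (mixedLabel ε) • (
        sandwich (imBlk n₁ n₂ n₃ false) (imBlk n₁ n₂ n₃ true) +
        sandwich (imBlk n₁ n₂ n₃ true) (imBlk n₁ n₂ n₃ false) -
        sandwichTranspose (imBlk n₁ n₂ n₃ false) (imBlk n₁ n₂ n₃ true) -
        sandwichTranspose (imBlk n₁ n₂ n₃ true) (imBlk n₁ n₂ n₃ false))))]
  · simp only [map_smul, map_sub, map_add, trace_sandwich, trace_sandwichTranspose,
      idBlk_transpose, imBlk_transpose, Matrix.mul_neg, idBlk_mul_idBlk, imBlk_mul_imBlk,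
      Bool.false_eq_true, Bool.true_eq_false, if_false, trace_idBlk, trace_imBlk, smul_eq_mul,
      Matrix.trace_neg, Matrix.trace_zero, blkSize]
    ring
  · intro M
    refine ⟨⟨_, ?_⟩, ?_, rfl⟩
    · rw [LieAlgebra.Orthogonal.mem_so]
      simp only [LinearMap.smul_apply, LinearMap.sub_apply, LinearMap.add_apply, sandwich_apply,
        sandwichTranspose_apply, Matrix.transpose_smul, Matrix.transpose_sub, Matrix.transpose_add,
        Matrix.transpose_mul, idBlk_transpose, imBlk_transpose, Matrix.transpose_transpose,
        Matrix.mul_neg, Matrix.neg_mul, neg_neg, Matrix.mul_assoc]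
      module
    · rw [mem_summand_mixedLabel_iff]
      simp only [LinearMap.smul_apply, LinearMap.sub_apply, LinearMap.add_apply, sandwich_apply,
        sandwichTranspose_apply, Matrix.mul_smul, Matrix.smul_mul, Matrix.mul_add, Matrix.add_mul,
        Matrix.mul_sub, Matrix.sub_mul, Matrix.mul_assoc, idBlk_mul_imBlk,
        imBlk_mul_imBlk,
        imBlk_mul_idBlk_mul, imBlk_mul_imBlk_mul, if_true, if_false, Bool.false_eq_true,
        Bool.true_eq_false, Matrix.mul_neg, Matrix.neg_mul, neg_neg,
        Matrix.zero_mul]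
      cases ε <;> simp only [crossCoeff, mixedLabel] <;> module
  · intro X hX
    have h := (mem_summand_mixedLabel_iff ε X).1 hX
    have hX' := eq_of_mem_summand_mixedLabel hX
    have h3 := congrArg (crossCoeff (mixedLabel ε) • ·) h
    simp only [smul_smul, crossCoeff_mixedLabel_mul_self, one_smul] at h3
    simp only [LinearMap.smul_apply, LinearMap.sub_apply, LinearMap.add_apply, sandwich_apply,
      sandwichTranspose_apply, transpose_coe, Matrix.mul_neg, Matrix.neg_mul]
    calc _ = (1 / 2 : ℝ) • (idBlk n₁ n₂ n₃ false * X.1 * idBlk n₁ n₂ n₃ true +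
          idBlk n₁ n₂ n₃ true * X.1 * idBlk n₁ n₂ n₃ false) +
          (1 / 2 : ℝ) • (crossCoeff (mixedLabel ε) • (imBlk n₁ n₂ n₃ false * X.1 *
          imBlk n₁ n₂ n₃ true + imBlk n₁ n₂ n₃ true * X.1 * imBlk n₁ n₂ n₃ false)) := by module
      _ = X.1 := by
        rw [← hX', h3]
        module

end Dimensions

/-! ### The matrices E_pq - E_qp: brackets, spans and sums of squares. -/

section SkewUnits

variable {ι : Type*} [Fintype ι] [DecidableEq ι]

/-- The skew-symmetric matrix `E_pq - E_qp`. -/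
def skewUnit (p q : ι) : LieAlgebra.Orthogonal.so ι ℝ :=
  ⟨single p q 1 - single q p 1, by
    rw [LieAlgebra.Orthogonal.mem_so]
    simp [Matrix.transpose_sub, Matrix.transpose_single]⟩

theorem coe_skewUnit (p q : ι) :
    (skewUnit p q : Matrix ι ι ℝ) = single p q 1 - single q p 1 := rfl

theorem skewUnit_apply (p q i j : ι) : (skewUnit p q).1 i j =
    (if p = i ∧ q = j then 1 else 0) - (if q = i ∧ p = j then 1 else 0) := by
  simp [coe_skewUnit, single_apply]

theorem killingForm_skewUnit (X : LieAlgebra.Orthogonal.so ι ℝ) (p q : ι) :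
    killingForm ℝ (LieAlgebra.Orthogonal.so ι ℝ) X (skewUnit p q) =
      -(2 * ((Fintype.card ι : ℝ) - 2) * X.1 p q) := by
  have h (p q : ι) : (X.1 * single p q (1 : ℝ)).trace = X.1 q p := by
    simp [Matrix.trace_mul_single]
  rw [killingForm_so, coe_skewUnit, Matrix.mul_sub, Matrix.trace_sub, h, h, coe_apply_swap X q p]
  ring

theorem killingForm_self (X : LieAlgebra.Orthogonal.so ι ℝ) :
    -killingForm ℝ (LieAlgebra.Orthogonal.so ι ℝ) X X =
      ((Fintype.card ι : ℝ) - 2) * ∑ p, ∑ q, X.1 p q ^ 2 := by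
  have : (X.1 * X.1).trace = -∑ p, ∑ q, X.1 p q ^ 2 := by
    simp only [Matrix.trace, Matrix.diag_apply, Matrix.mul_apply, ← Finset.sum_neg_distrib]
    refine Finset.sum_congr rfl fun p _ => Finset.sum_congr rfl fun q _ => ?_
    rw [coe_apply_swap X q p]
    ring
  rw [killingForm_so, this]
  ring

theorem killingForm_self_neg (hι : 2 < Fintype.card ι) (X : LieAlgebra.Orthogonal.so ι ℝ)
    (hX : X ≠ 0) : killingForm ℝ (LieAlgebra.Orthogonal.so ι ℝ) X X < 0 := by
  have hK : (0 : ℝ) < (Fintype.card ι : ℝ) - 2 := by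
    have : (2 : ℝ) < Fintype.card ι := by exact_mod_cast hι
    linarith
  have hne : ∃ p q, X.1 p q ≠ 0 := by
    by_contra! h
    exact hX (Subtype.ext (Matrix.ext h))
  obtain ⟨p, q, hpq⟩ := hne
  have h1 : 0 < ∑ p, ∑ q, X.1 p q ^ 2 :=
    Finset.sum_pos' (fun p _ => Finset.sum_nonneg fun q _ => sq_nonneg _)
      ⟨p, Finset.mem_univ _, Finset.sum_pos' (fun q _ => sq_nonneg _)
        ⟨q, Finset.mem_univ _, by positivity⟩⟩
  have := killingForm_self X
  have := mul_pos hK h1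
  linarith

/-- By invariance this is `B([X, E_pr - E_rp], E_qs - E_sq)`, and pairing with a skew unit reads off
one entry of the commutator. -/
theorem killingForm_lie_skewUnit (X : LieAlgebra.Orthogonal.so ι ℝ) (p r q s : ι) :
    killingForm ℝ (LieAlgebra.Orthogonal.so ι ℝ) X ⁅skewUnit p r, skewUnit q s⁆ =
      -(2 * ((Fintype.card ι : ℝ) - 2) *
        ((if r = s then X.1 q p else 0) - (if p = s then X.1 q r else 0) -
          (if q = p then X.1 r s else 0) + if q = r then X.1 p s else 0)) := by
  have h1 (a b : ι) : (X.1 * single a b (1 : ℝ)) q s = if b = s then X.1 q a else 0 := by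
    have := mul_single_mul_apply X.1 1 a b q s
    rw [Matrix.mul_one] at this
    simp [this, one_apply]
  have h2 (a b : ι) : (single a b (1 : ℝ) * X.1) q s = if q = a then X.1 b s else 0 := by
    have := mul_single_mul_apply 1 X.1 a b q s
    rw [Matrix.one_mul] at this
    simp [this, one_apply]
  rw [← killingForm_lie_left, killingForm_skewUnit, coe_lie, coe_skewUnit, Matrix.mul_sub,
    Matrix.sub_mul, Matrix.sub_apply, Matrix.sub_apply, Matrix.sub_apply, h1, h1, h2, h2]
  ring

variable {A B C : Type*} [Fintype A] [Fintype B] [Fintype C]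

/-- Two skew units sharing the index `h c` bracket to the skew unit of their other two indices, up
to sign. With distinct `h`-indices the bracket can be nonzero only inside the `h`-block, where `X`
vanishes. So every entry of `X` on `f × g` is counted once for each `c`. -/
theorem sum_killingForm_lie_skewUnit_sq (X : LieAlgebra.Orthogonal.so ι ℝ) (f : A → ι) (g : B → ι)
    {h : C → ι} (hh : Function.Injective h) (hf : ∀ a c, f a ≠ h c) (hg : ∀ b c, g b ≠ h c)
    (hX : ∀ c c', X.1 (h c) (h c') = 0) :
    ∑ s : A × C, ∑ t : B × C, killingForm ℝ (LieAlgebra.Orthogonal.so ι ℝ) X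
        ⁅skewUnit (f s.1) (h s.2), skewUnit (g t.1) (h t.2)⁆ ^ 2 =
      (2 * ((Fintype.card ι : ℝ) - 2)) ^ 2 * Fintype.card C *
        ∑ a, ∑ b, X.1 (f a) (g b) ^ 2 := by
  classical
  have key (a : A) (c : C) (b : B) (c' : C) : killingForm ℝ (LieAlgebra.Orthogonal.so ι ℝ) X
      ⁅skewUnit (f a) (h c), skewUnit (g b) (h c')⁆ ^ 2 =
      if c = c' then (2 * ((Fintype.card ι : ℝ) - 2)) ^ 2 * X.1 (f a) (g b) ^ 2 else 0 := by
    rw [killingForm_lie_skewUnit, if_neg (hf a c'), if_neg (hg b c), hX, coe_apply_swap X (g b)]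
    simp only [hh.eq_iff, ite_self, sub_zero, add_zero]
    split_ifs <;> ring
  simp only [Fintype.sum_prod_type, key, Finset.sum_ite_eq, Finset.mem_univ, if_true]
  simp only [← Finset.mul_sum, Finset.sum_const, Finset.card_univ, nsmul_eq_mul]
  ring

/-- `X` is supported on the off-diagonal blocks given by the ranges of `f` and `h`. -/
def IsOffDiagonal (f : A → ι) (h : C → ι) (X : LieAlgebra.Orthogonal.so ι ℝ) : Prop :=
  ∀ p q, X.1 p q ≠ 0 → (p ∈ Set.range f ∧ q ∈ Set.range h) ∨ (p ∈ Set.range h ∧ q ∈ Set.range f)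

theorem IsOffDiagonal.mem_span {f : A → ι} {h : C → ι} (hf : Function.Injective f)
    (hh : Function.Injective h) (hfh : ∀ a c, f a ≠ h c) {X : LieAlgebra.Orthogonal.so ι ℝ}
    (hX : IsOffDiagonal f h X) :
    X ∈ Submodule.span ℝ (Set.range fun s : A × C => skewUnit (f s.1) (h s.2)) := by
  classical
  have key : X = ∑ s : A × C, X.1 (f s.1) (h s.2) • skewUnit (f s.1) (h s.2) := by
    apply Subtype.ext
    ext p q
    have hsum : (∑ s : A × C, X.1 (f s.1) (h s.2) • skewUnit (f s.1) (h s.2) :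
        LieAlgebra.Orthogonal.so ι ℝ).1 p q =
        ∑ s : A × C, X.1 (f s.1) (h s.2) * (skewUnit (f s.1) (h s.2)).1 p q := by
      rw [AddSubmonoidClass.coe_finsetSum, Matrix.sum_apply]
      rfl
    rw [hsum]
    by_cases h0 : X.1 p q = 0
    · rw [h0]
      refine (Finset.sum_eq_zero fun s _ => ?_).symm
      rw [skewUnit_apply]
      by_cases h1 : f s.1 = p ∧ h s.2 = q
      · rw [h1.1, h1.2, h0, zero_mul]
      · by_cases h2 : h s.2 = p ∧ f s.1 = q
        · rw [h2.1, h2.2, coe_apply_swap, h0, neg_zero, zero_mul]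
        · rw [if_neg h1, if_neg h2, sub_zero, mul_zero]
    · rcases hX p q h0 with ⟨⟨a, rfl⟩, ⟨c, rfl⟩⟩ | ⟨⟨c, rfl⟩, ⟨a, rfl⟩⟩
      · rw [Finset.sum_eq_single (a, c)]
        · simp [skewUnit_apply, (hfh a c).symm]
        · rintro ⟨a', c'⟩ - hne
          simp only [skewUnit_apply, hf.eq_iff, hh.eq_iff, (hfh a c').symm, false_and, if_false]
          rw [if_neg (by simpa using hne)]
          simp
        · simp
      · rw [Finset.sum_eq_single (a, c)]
        · simp [skewUnit_apply, hfh a c, coe_apply_swap X (h c)]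
        · rintro ⟨a', c'⟩ - hne
          simp only [skewUnit_apply, hf.eq_iff, hh.eq_iff, hfh a' c, false_and, if_false]
          rw [if_neg (by rintro ⟨rfl, rfl⟩; exact hne rfl)]
          simp
        · simp
  rw [key]
  exact Submodule.sum_mem _ fun s _ => Submodule.smul_mem _ _ (Submodule.subset_span ⟨s, rfl⟩)

/-- Orthonormal families spanning the off-diagonal block of `f` and `h` can be replaced by the
normalized matrices `E_pq - E_qp` in sums of squares. -/
theorem sum_sq_eq_of_isOffDiagonal (hι : 2 < Fintype.card ι) {f : A → ι} {h : C → ι}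
    (hf : Function.Injective f) (hh : Function.Injective h) (hfh : ∀ a c, f a ≠ h c) {κ : Type*}
    [Fintype κ] [DecidableEq κ] {x : κ → LieAlgebra.Orthogonal.so ι ℝ}
    (hx : IsNegOrthonormal (killingForm ℝ (LieAlgebra.Orthogonal.so ι ℝ)) x)
    (hxs : ∀ s, IsOffDiagonal f h (x s))
    (hsx : ∀ a c, skewUnit (f a) (h c) ∈ Submodule.span ℝ (Set.range x))
    (φ : LieAlgebra.Orthogonal.so ι ℝ →ₗ[ℝ] ℝ) :
    ∑ s, φ (x s) ^ 2 = (2 * ((Fintype.card ι : ℝ) - 2))⁻¹ *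
      ∑ t : A × C, φ (skewUnit (f t.1) (h t.2)) ^ 2 := by
  classical
  have hK : (0 : ℝ) < 2 * ((Fintype.card ι : ℝ) - 2) := by
    have : (2 : ℝ) < Fintype.card ι := by exact_mod_cast hι
    linarith
  -- For `p ≠ q`, `E_pq - E_qp` has squared norm `2(N-2)` under `-B`.
  set k : ℝ := (√(2 * ((Fintype.card ι : ℝ) - 2)))⁻¹ with hk
  have hk2 : k ^ 2 = (2 * ((Fintype.card ι : ℝ) - 2))⁻¹ := by
    rw [hk, inv_pow, Real.sq_sqrt hK.le]
  have hk0 : k ≠ 0 := by positivity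
  have hy : IsNegOrthonormal (killingForm ℝ (LieAlgebra.Orthogonal.so ι ℝ))
      fun t : A × C => k • skewUnit (f t.1) (h t.2) := by
    rintro ⟨a, c⟩ ⟨b, d⟩
    simp only [map_smul, LinearMap.smul_apply, smul_eq_mul, killingForm_skewUnit, skewUnit_apply,
      hf.eq_iff, hh.eq_iff, (hfh b c).symm, false_and, if_false, Prod.mk.injEq]
    split_ifs
    · have : k ^ 2 * (2 * ((Fintype.card ι : ℝ) - 2)) = 1 := by
        rw [hk2, inv_mul_cancel₀ hK.ne']
      linear_combination this
    · simp
  rw [hx.sum_sq_eq killingForm_comm hy _ _ φ, Finset.mul_sum, ← hk2]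
  · simp only [map_smul, smul_eq_mul, mul_pow]
  · intro s
    have h1 := (hxs s).mem_span hf hh hfh
    refine Submodule.span_le.2 ?_ h1
    rintro _ ⟨t, rfl⟩
    have h2 : k • skewUnit (f t.1) (h t.2) ∈ Submodule.span ℝ
      (Set.range fun t : A × C => k • skewUnit (f t.1) (h t.2)) := Submodule.subset_span ⟨t, rfl⟩
    have h3 := Submodule.smul_mem _ k⁻¹ h2
    rwa [smul_smul, inv_mul_cancel₀ hk0, one_smul] at h3
  · exact fun t => Submodule.smul_mem _ _ (hsx _ _)

end SkewUnits

/-! ### Computing a structure constant one unit vector at a time. -/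

section StructureConstants

variable {L : Type*} [LieRing L] [LieAlgebra ℝ L]

/-- A structure constant as the dimension of `U` times a constant. -/
theorem isStructureConstant_of_forall [Module.Finite ℝ L]
    (hneg : ∀ u : L, u ≠ 0 → killingForm ℝ L u u < 0) {U V W : Submodule ℝ L} {c : ℝ}
    (h : ∀ v ∈ U, -killingForm ℝ L v v = 1 →
      ∀ (y : Module.Basis (Fin (Module.finrank ℝ V)) ℝ V)
        (z : Module.Basis (Fin (Module.finrank ℝ W)) ℝ W),
        IsOrthonormalBasis y → IsOrthonormalBasis z →
        ∑ t, ∑ u, (killingForm ℝ L v ⁅(y t : L), (z u : L)⁆) ^ 2 = c) :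
    IsStructureConstant U V W (Module.finrank ℝ U * c) := by
  refine ⟨exists_negOrthonormal_basis _ killingForm_comm hneg U,
    exists_negOrthonormal_basis _ killingForm_comm hneg V,
    exists_negOrthonormal_basis _ killingForm_comm hneg W, fun x y z hx hy hz => ?_⟩
  rw [Finset.sum_congr rfl fun s _ => h (x s) (x s).2 (by simpa using hx s s) y z hy hz]
  simp

/-- With one bracket argument fixed, `B(v,[y,z])` is a linear functional of the other, so each
family is replaced in turn and contributes one factor `k`. -/
theorem sum_killingForm_lie_sq_eq (v : L) {κ κ' τ τ' : Type*} [Fintype κ] [Fintype κ'] [Fintype τ]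
    [Fintype τ'] {y : κ → L} {z : κ' → L} {u : τ → L} {w : τ' → L} {k : ℝ}
    (hy : ∀ φ : L →ₗ[ℝ] ℝ, ∑ s, φ (y s) ^ 2 = k * ∑ t, φ (u t) ^ 2)
    (hz : ∀ φ : L →ₗ[ℝ] ℝ, ∑ s, φ (z s) ^ 2 = k * ∑ t, φ (w t) ^ 2) :
    ∑ s, ∑ s', killingForm ℝ L v ⁅y s, z s'⁆ ^ 2 =
      k ^ 2 * ∑ t, ∑ t', killingForm ℝ L v ⁅u t, w t'⁆ ^ 2 := by
  have h1 (s : κ) := hz (killingForm ℝ L v ∘ₗ (LieAlgebra.ad ℝ L (y s) : L →ₗ[ℝ] L))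
  have h2 (t : τ') := hy (killingForm ℝ L v ∘ₗ (LieAlgebra.ad ℝ L (w t) : L →ₗ[ℝ] L))
  simp only [LinearMap.comp_apply, LieAlgebra.ad_apply] at h1 h2
  have h3 (a b : L) : killingForm ℝ L v ⁅a, b⁆ ^ 2 = killingForm ℝ L v ⁅b, a⁆ ^ 2 := by
    rw [killingForm_lie_swap_right v b a, neg_sq]
  simp only [h1]
  rw [← Finset.mul_sum, Finset.sum_comm]
  simp only [h3 (y _) (w _), h2]
  rw [← Finset.mul_sum, Finset.sum_comm]
  simp only [h3 (w _) (u _)]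
  ring

/-- `(ad Z)²` is self-adjoint for the Killing form, so distinct eigenvalues give orthogonal
eigenvectors. -/
theorem killingForm_eq_zero_of_lie_lie {Z x y : L} {c d : ℝ} (hcd : c ≠ d)
    (hx : ⁅Z, ⁅Z, x⁆⁆ = -(c • x)) (hy : ⁅Z, ⁅Z, y⁆⁆ = -(d • y)) : killingForm ℝ L x y = 0 := by
  have h : killingForm ℝ L ⁅Z, ⁅Z, x⁆⁆ y = killingForm ℝ L x ⁅Z, ⁅Z, y⁆⁆ := by
    rw [killingForm_lie_left, killingForm_lie_swap_left, killingForm_lie_left,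
      killingForm_lie_swap_left Z x]
  rw [hx, hy, map_neg, map_neg, map_smul, map_smul, LinearMap.neg_apply, LinearMap.smul_apply,
    smul_eq_mul, smul_eq_mul] at h
  have : (c - d) * killingForm ℝ L x y = 0 := by linarith
  exact (mul_eq_zero.1 this).resolve_left (sub_ne_zero.2 hcd)

theorem mem_span_basis {M : Type*} [AddCommGroup M] [Module ℝ M] {U : Submodule ℝ M} {κ : Type*}
    [Fintype κ] (b : Module.Basis κ ℝ U) {v : M} (hv : v ∈ U) :
    v ∈ Submodule.span ℝ (Set.range fun s => (b s : M)) := by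
  refine (Submodule.mem_span_range_iff_exists_fun ℝ).2 ⟨fun s => b.repr ⟨v, hv⟩ s, ?_⟩
  have := congrArg Subtype.val (b.sum_repr ⟨v, hv⟩)
  rwa [AddSubmonoidClass.coe_finsetSum] at this

end StructureConstants

/-! ### Skew units inside the flag summands, and vanishing by weights. -/

section Flag

variable {n₁ n₂ n₃ : ℕ}

/-- The basis vectors of a complex block. -/
def blkEmb : (α : Bool) → Fin (blkSize n₁ n₂ α) × Fin 2 → Idx n₁ n₂ n₃
  | false => Sum.inl
  | true => Sum.inr ∘ Sum.inl

/-- The basis vectors of the real block. -/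
def realEmb : Fin (2 * n₃ + 1) → Idx n₁ n₂ n₃ := Sum.inr ∘ Sum.inr

theorem blkEmb_injective (α : Bool) :
    Function.Injective (blkEmb (n₁ := n₁) (n₂ := n₂) (n₃ := n₃) α) := by
  cases α
  · exact Sum.inl_injective
  · exact Sum.inr_injective.comp Sum.inl_injective

theorem realEmb_injective : Function.Injective (realEmb (n₁ := n₁) (n₂ := n₂) (n₃ := n₃)) :=
  Sum.inr_injective.comp Sum.inr_injective

theorem blk_eq_some_iff (α : Bool) (p : Idx n₁ n₂ n₃) :
    blk p = some α ↔ p ∈ Set.range (blkEmb α) := by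
  constructor
  · intro h
    cases α <;> rcases p with p | p | p <;> first
      | exact ⟨p, rfl⟩
      | simp [blk] at h
  · rintro ⟨a, rfl⟩
    cases α <;> rfl

theorem blk_eq_none_iff (p : Idx n₁ n₂ n₃) : blk p = none ↔ p ∈ Set.range realEmb := by
  rcases p with p | p | p <;> simp [blk, realEmb]

theorem blk_blkEmb (α : Bool) (a : Fin (blkSize n₁ n₂ α) × Fin 2) :
    blk (n₃ := n₃) (blkEmb α a) = some α :=
  (blk_eq_some_iff α _).2 ⟨a, rfl⟩

theorem blk_realEmb (r : Fin (2 * n₃ + 1)) : blk (realEmb (n₁ := n₁) (n₂ := n₂) r) = none :=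
  (blk_eq_none_iff _).2 ⟨r, rfl⟩

theorem blkEmb_ne_realEmb (α : Bool) (a : Fin (blkSize n₁ n₂ α) × Fin 2) (r : Fin (2 * n₃ + 1)) :
    blkEmb α a ≠ realEmb r := fun h => by
  have := congrArg blk h
  simp [blk_blkEmb, blk_realEmb] at this

theorem blkEmb_ne_blkEmb_not (α : Bool) (a : Fin (blkSize n₁ n₂ α) × Fin 2)
    (b : Fin (blkSize n₁ n₂ (!α)) × Fin 2) : blkEmb (n₃ := n₃) α a ≠ blkEmb (!α) b := fun h => by
  have := congrArg blk h
  simp [blk_blkEmb] at this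

theorem sum_idx (α : Bool) (f : Idx n₁ n₂ n₃ → ℝ) :
    ∑ p, f p = ∑ a, f (blkEmb α a) + (∑ b, f (blkEmb (!α) b) + ∑ r, f (realEmb r)) := by
  cases α
  · simp only [Fintype.sum_sum_type]
    rfl
  · rw [← add_assoc, add_comm (∑ a, f (blkEmb true a)), add_assoc]
    simp only [Fintype.sum_sum_type]
    rfl

theorem card_idx_sub_two :
    (Fintype.card (Idx n₁ n₂ n₃) : ℝ) - 2 = 2 * ((n₁ : ℝ) + n₂ + n₃) - 1 := by
  rw [card_idx]
  push_cast
  ring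

theorem isOffDiagonal_of_mem_shortLabel {α : Bool} {X : G n₁ n₂ n₃}
    (hX : X ∈ summand n₁ n₂ n₃ (shortLabel α)) : IsOffDiagonal (blkEmb α) realEmb X := by
  intro p q h
  simpa only [blk_eq_some_iff, blk_eq_none_iff] using (mem_summand_shortLabel_iff α X).1 hX p q h

theorem skewUnit_mem_shortLabel (α : Bool) (a : Fin (blkSize n₁ n₂ α) × Fin 2)
    (r : Fin (2 * n₃ + 1)) :
    skewUnit (blkEmb α a) (realEmb r) ∈ summand n₁ n₂ n₃ (shortLabel α) := by
  rw [mem_summand_shortLabel_iff]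
  intro p q h
  rw [skewUnit_apply] at h
  by_cases h1 : blkEmb α a = p ∧ realEmb r = q
  · left
    rw [← h1.1, ← h1.2, blk_blkEmb, blk_realEmb]
    exact ⟨rfl, rfl⟩
  · by_cases h2 : realEmb r = p ∧ blkEmb α a = q
    · right
      rw [← h2.1, ← h2.2, blk_blkEmb, blk_realEmb]
      exact ⟨rfl, rfl⟩
    · simp [h1, h2] at h

theorem isOffDiagonal_of_mem_mixedLabel {ε : Bool} {X : G n₁ n₂ n₃}
    (hX : X ∈ summand n₁ n₂ n₃ (mixedLabel ε)) (α : Bool) :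
    IsOffDiagonal (blkEmb α) (blkEmb (!α)) X := by
  intro p q h
  rw [eq_of_mem_summand_mixedLabel hX, Matrix.add_apply, mul_idBlk_apply, mul_idBlk_apply,
    idBlk_mul_apply, idBlk_mul_apply] at h
  rw [← blk_eq_some_iff, ← blk_eq_some_iff, ← blk_eq_some_iff, ← blk_eq_some_iff]
  by_cases h1 : blk p = some false ∧ blk q = some true
  · cases α <;> simp [h1]
  · by_cases h2 : blk p = some true ∧ blk q = some false
    · cases α <;> simp [h2]
    · exfalso
      apply h
      split_ifs with h3 h4 h5 h6 <;> simp_all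

/-- On matrices supported between the two complex blocks, `X ↦ J₁XJ₂ + J₂XJ₁` is an involution whose
eigenspaces for `-1` and `+1` are the summands of `a - b` and `a + b`. The components are `(X ∓
T)/2`, where `T` is the image of `X`. -/
theorem exists_add_of_idBlk (X : G n₁ n₂ n₃)
    (hX : X.1 = idBlk n₁ n₂ n₃ false * X.1 * idBlk n₁ n₂ n₃ true +
      idBlk n₁ n₂ n₃ true * X.1 * idBlk n₁ n₂ n₃ false) :
    ∃ Y ∈ summand n₁ n₂ n₃ (mixedLabel false), ∃ Z ∈ summand n₁ n₂ n₃ (mixedLabel true),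
      X = Y + Z := by
  set T : Matrix (Idx n₁ n₂ n₃) (Idx n₁ n₂ n₃) ℝ :=
    imBlk n₁ n₂ n₃ false * X.1 * imBlk n₁ n₂ n₃ true +
      imBlk n₁ n₂ n₃ true * X.1 * imBlk n₁ n₂ n₃ false with hT
  have hTs : T ∈ LieAlgebra.Orthogonal.so (Idx n₁ n₂ n₃) ℝ := by
    rw [LieAlgebra.Orthogonal.mem_so, hT]
    simp only [Matrix.transpose_add, Matrix.transpose_mul, imBlk_transpose, transpose_coe,
      Matrix.mul_neg, Matrix.neg_mul, neg_neg, Matrix.mul_assoc]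
    abel
  have hTT : imBlk n₁ n₂ n₃ false * T * imBlk n₁ n₂ n₃ true +
      imBlk n₁ n₂ n₃ true * T * imBlk n₁ n₂ n₃ false = X.1 := by
    conv_rhs => rw [hX]
    rw [hT]
    simp [Matrix.mul_add, Matrix.mul_assoc, imBlk_mul_imBlk, imBlk_mul_imBlk_mul]
  have hmem (ε : Bool) : (1 / 2 : ℝ) • (X + crossCoeff (mixedLabel ε) • (⟨T, hTs⟩ : G n₁ n₂ n₃)) ∈
      summand n₁ n₂ n₃ (mixedLabel ε) := by
    rw [mem_summand_mixedLabel_iff]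
    simp only [SetLike.val_smul, AddMemClass.coe_add, Matrix.mul_smul, Matrix.smul_mul,
      Matrix.mul_add, Matrix.add_mul]
    calc _ = (1 / 2 : ℝ) • (T + crossCoeff (mixedLabel ε) •
          (imBlk n₁ n₂ n₃ false * T * imBlk n₁ n₂ n₃ true +
            imBlk n₁ n₂ n₃ true * T * imBlk n₁ n₂ n₃ false)) := by rw [hT]; module
      _ = (1 / 2 : ℝ) • ((crossCoeff (mixedLabel ε) * crossCoeff (mixedLabel ε)) • T +
          crossCoeff (mixedLabel ε) • X.1) := by
          rw [hTT, crossCoeff_mixedLabel_mul_self, one_smul]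
      _ = _ := by module
  refine ⟨_, hmem false, _, hmem true, ?_⟩
  simp only [crossCoeff, mixedLabel]
  module

theorem skewUnit_eq_add (α : Bool) (a : Fin (blkSize n₁ n₂ α) × Fin 2)
    (b : Fin (blkSize n₁ n₂ (!α)) × Fin 2) :
    ∃ Y ∈ summand n₁ n₂ n₃ (mixedLabel false), ∃ Z ∈ summand n₁ n₂ n₃ (mixedLabel true),
      skewUnit (blkEmb α a) (blkEmb (!α) b) = Y + Z := by
  apply exists_add_of_idBlk
  ext p q
  rw [Matrix.add_apply, mul_idBlk_apply, mul_idBlk_apply, idBlk_mul_apply, idBlk_mul_apply,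
    skewUnit_apply]
  by_cases h1 : blkEmb α a = p ∧ blkEmb (!α) b = q
  · obtain ⟨rfl, rfl⟩ := h1
    cases α <;> simp [blk_blkEmb]
  · by_cases h2 : blkEmb (!α) b = p ∧ blkEmb α a = q
    · obtain ⟨rfl, rfl⟩ := h2
      cases α <;> simp [blk_blkEmb]
    · simp [h1, h2]

theorem killingForm_lie_eq_zero_of_summand {i j k : Label} {x y z : G n₁ n₂ n₃}
    (hx : x ∈ summand n₁ n₂ n₃ i) (hy : y ∈ summand n₁ n₂ n₃ j) (hz : z ∈ summand n₁ n₂ n₃ k)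
    (h1 : ({i, j, k} : Multiset Label) ≠ {.one, .three, .four})
    (h2 : ({i, j, k} : Multiset Label) ≠ {.two, .three, .four})
    (h3 : ({i, j, k} : Multiset Label) ≠ {.three, .five, .six})
    (h4 : ({i, j, k} : Multiset Label) ≠ {.four, .five, .six})
    (h5 : ({i, j, k} : Multiset Label) ≠ {.one, .five, .five})
    (h6 : ({i, j, k} : Multiset Label) ≠ {.two, .six, .six}) :
    killingForm ℝ (G n₁ n₂ n₃) x ⁅y, z⁆ = 0 := by
  -- At `(10,1)` the roots are 20, 2, 9, 11, 10, 1. This point is generic enough that a signed sum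
  -- of three of them vanishes only for the six excluded triples.
  refine killingForm_lie_eq_zero (hx.2 10 1) (hy.2 10 1) (hz.2 10 1) ?_
  clear hx hy hz
  cases i <;> cases j <;> cases k <;> first
    | exact absurd (by decide) h1
    | exact absurd (by decide) h2
    | exact absurd (by decide) h3
    | exact absurd (by decide) h4
    | exact absurd (by decide) h5
    | exact absurd (by decide) h6
    | norm_num [tRoot]

end Flag

/-! ### Evaluation of the structure constants. -/

section Values

variable {n₁ n₂ n₃ : ℕ}

theorem two_lt_card_idx (h₁ : 1 < n₁) : 2 < Fintype.card (Idx n₁ n₂ n₃) := by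
  rw [card_idx]
  omega

theorem sum_sq_shortLabel (h₁ : 1 < n₁) {α : Bool} {N : ℕ}
    {y : Module.Basis (Fin N) ℝ (summand n₁ n₂ n₃ (shortLabel α))} (hy : IsOrthonormalBasis y)
    (φ : G n₁ n₂ n₃ →ₗ[ℝ] ℝ) :
    ∑ s, φ (y s) ^ 2 = (2 * ((Fintype.card (Idx n₁ n₂ n₃) : ℝ) - 2))⁻¹ *
      ∑ t : (Fin (blkSize n₁ n₂ α) × Fin 2) × Fin (2 * n₃ + 1),
        φ (skewUnit (blkEmb α t.1) (realEmb t.2)) ^ 2 :=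
  sum_sq_eq_of_isOffDiagonal (two_lt_card_idx h₁) (blkEmb_injective α) realEmb_injective
    (blkEmb_ne_realEmb α) (x := fun s => (y s : G n₁ n₂ n₃)) hy
    (fun s => isOffDiagonal_of_mem_shortLabel (y s).2)
    (fun a r => mem_span_basis y (skewUnit_mem_shortLabel α a r)) φ

/-- Neither mixed summand is spanned by skew units, but together their bases form an orthonormal
basis of the whole space between the two complex blocks. The parameter `α` chooses which block is
listed first, so that the other can serve as the common block of two skew units. -/
theorem sum_sq_mixedLabel (h₁ : 1 < n₁) (α : Bool) {N N' : ℕ}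
    {y : Module.Basis (Fin N) ℝ (summand n₁ n₂ n₃ (mixedLabel false))} (hy : IsOrthonormalBasis y)
    {z : Module.Basis (Fin N') ℝ (summand n₁ n₂ n₃ (mixedLabel true))} (hz : IsOrthonormalBasis z)
    (φ : G n₁ n₂ n₃ →ₗ[ℝ] ℝ) :
    ∑ s, φ (Sum.elim (fun s => (y s : G n₁ n₂ n₃)) (fun s => (z s : G n₁ n₂ n₃)) s) ^ 2 =
      (2 * ((Fintype.card (Idx n₁ n₂ n₃) : ℝ) - 2))⁻¹ *
      ∑ t : (Fin (blkSize n₁ n₂ α) × Fin 2) × (Fin (blkSize n₁ n₂ (!α)) × Fin 2),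
        φ (skewUnit (blkEmb α t.1) (blkEmb (!α) t.2)) ^ 2 := by
  have horth (s : Fin N) (t : Fin N') :
      killingForm ℝ (G n₁ n₂ n₃) (y s : G n₁ n₂ n₃) (z t : G n₁ n₂ n₃) = 0 :=
    -- At `(10,1)` the squares of `a - b` and `a + b` are 81 and 121.
    killingForm_eq_zero_of_lie_lie (by norm_num [tRoot, mixedLabel]) ((y s).2.2 10 1)
      ((z t).2.2 10 1)
  refine sum_sq_eq_of_isOffDiagonal (two_lt_card_idx h₁) (blkEmb_injective α)
    (blkEmb_injective (!α)) (blkEmb_ne_blkEmb_not α) ?_ ?_ ?_ φ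
  · rintro (s | s) (t | t)
    · simpa using hy s t
    · simpa using horth s t
    · simpa [killingForm_comm (z s : G n₁ n₂ n₃)] using horth t s
    · simpa using hz s t
  · rintro (s | s)
    · exact isOffDiagonal_of_mem_mixedLabel (y s).2 α
    · exact isOffDiagonal_of_mem_mixedLabel (z s).2 α
  · intro a b
    obtain ⟨Y, hY, Z, hZ, h⟩ := skewUnit_eq_add α a b
    rw [h]
    refine Submodule.add_mem _ (Submodule.span_mono ?_ (mem_span_basis y hY))
      (Submodule.span_mono ?_ (mem_span_basis z hZ))
    · rintro _ ⟨s, rfl⟩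
      exact ⟨Sum.inl s, rfl⟩
    · rintro _ ⟨s, rfl⟩
      exact ⟨Sum.inr s, rfl⟩

theorem apply_eq_zero_of_mem_longLabel {α : Bool} {X : G n₁ n₂ n₃}
    (hX : X ∈ summand n₁ n₂ n₃ (longLabel α)) {p q : Idx n₁ n₂ n₃}
    (h : blk p ≠ some α ∨ blk q ≠ some α) : X.1 p q = 0 := by
  rw [← ((mem_summand_longLabel_iff α X).1 hX).1, mul_idBlk_apply, idBlk_mul_apply]
  rcases h with h | h <;> simp [h]

theorem apply_eq_zero_of_mem_mixedLabel {ε : Bool} {X : G n₁ n₂ n₃}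
    (hX : X ∈ summand n₁ n₂ n₃ (mixedLabel ε)) {p q : Idx n₁ n₂ n₃}
    (h : blk p = none ∨ blk q = none ∨ blk p = blk q) : X.1 p q = 0 := by
  by_contra h0
  have := isOffDiagonal_of_mem_mixedLabel hX false p q h0
  rw [← blk_eq_some_iff, ← blk_eq_some_iff, ← blk_eq_some_iff, ← blk_eq_some_iff] at this
  rcases this with ⟨hp, hq⟩ | ⟨hp, hq⟩ <;> simp [hp, hq] at h

theorem sum_sq_of_mem_longLabel {α : Bool} {X : G n₁ n₂ n₃}
    (hX : X ∈ summand n₁ n₂ n₃ (longLabel α)) (hX1 : -killingForm ℝ (G n₁ n₂ n₃) X X = 1) :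
    ((Fintype.card (Idx n₁ n₂ n₃) : ℝ) - 2) * ∑ a, ∑ b, X.1 (blkEmb α a) (blkEmb α b) ^ 2 = 1 := by
  have h (p q : Idx n₁ n₂ n₃) (h : blk p ≠ some α ∨ blk q ≠ some α) : X.1 p q = 0 :=
    apply_eq_zero_of_mem_longLabel hX h
  rw [killingForm_self] at hX1
  simp only [sum_idx α] at hX1
  simpa [h, blk_blkEmb, blk_realEmb] using hX1

/-- The factor 2, absent for long roots, comes from the two mirror blocks of `X`, which have equal
norm by skew-symmetry. -/
theorem sum_sq_of_mem_mixedLabel {ε : Bool} {X : G n₁ n₂ n₃}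
    (hX : X ∈ summand n₁ n₂ n₃ (mixedLabel ε)) (hX1 : -killingForm ℝ (G n₁ n₂ n₃) X X = 1)
    (α : Bool) :
    2 * ((Fintype.card (Idx n₁ n₂ n₃) : ℝ) - 2) *
      ∑ a, ∑ b, X.1 (blkEmb α a) (blkEmb (!α) b) ^ 2 = 1 := by
  have h (p q : Idx n₁ n₂ n₃) (h : blk p = none ∨ blk q = none ∨ blk p = blk q) : X.1 p q = 0 :=
    apply_eq_zero_of_mem_mixedLabel hX h
  have hs : ∑ b, ∑ a, X.1 (blkEmb (!α) b) (blkEmb α a) ^ 2 =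
      ∑ a, ∑ b, X.1 (blkEmb α a) (blkEmb (!α) b) ^ 2 := by
    rw [Finset.sum_comm]
    refine Finset.sum_congr rfl fun a _ => Finset.sum_congr rfl fun b _ => ?_
    rw [coe_apply_swap, neg_sq]
  rw [killingForm_self] at hX1
  simp only [sum_idx α] at hX1
  simp only [h, blk_blkEmb, blk_realEmb, true_or, or_true, ne_eq, OfNat.ofNat_ne_zero,
    not_false_eq_true, zero_pow, Finset.sum_const_zero, zero_add, add_zero] at hX1
  rw [hs] at hX1
  linarith

theorem card_idx_sub_two_pos (h₁ : 1 < n₁) : 0 < (Fintype.card (Idx n₁ n₂ n₃) : ℝ) - 2 := by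
  have : (2 : ℝ) < Fintype.card (Idx n₁ n₂ n₃) := by exact_mod_cast two_lt_card_idx h₁
  linarith

/-- The real block, of size `2n₃+1`, is the common one. Each unit vector contributes `(2n₃+1)/D`,
and the long summand has dimension `n(n-1)` with `n` the size of block `α`. -/
theorem flagStructureConstant_long_short_short (h₁ : 1 < n₁) (α : Bool) :
    FlagStructureConstant n₁ n₂ n₃ (longLabel α) (shortLabel α) (shortLabel α)
      ((blkSize n₁ n₂ α : ℝ) * (blkSize n₁ n₂ α - 1) * (2 * n₃ + 1) /
        (2 * ((n₁ : ℝ) + n₂ + n₃) - 1)) := by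
  rw [mul_div_assoc, ← finrank_summand_longLabel (n₃ := n₃)]
  refine isStructureConstant_of_forall (killingForm_self_neg (two_lt_card_idx h₁))
    fun v hv hv1 y z hy hz => ?_
  have hK := card_idx_sub_two_pos (n₂ := n₂) (n₃ := n₃) h₁
  rw [sum_killingForm_lie_sq_eq v (sum_sq_shortLabel h₁ hy) (sum_sq_shortLabel h₁ hz),
    sum_killingForm_lie_skewUnit_sq v (blkEmb α) (blkEmb α) realEmb_injective
      (blkEmb_ne_realEmb α) (blkEmb_ne_realEmb α)
      (fun c c' => apply_eq_zero_of_mem_longLabel hv (by simp [blk_realEmb])), ← card_idx_sub_two]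
  have := sum_sq_of_mem_longLabel hv hv1
  rw [Fintype.card_fin]
  push_cast
  field_simp
  linear_combination this

theorem flagStructureConstant_mixed_short_short (h₁ : 1 < n₁) (ε α : Bool) :
    FlagStructureConstant n₁ n₂ n₃ (mixedLabel ε) (shortLabel α) (shortLabel (!α))
      ((n₁ : ℝ) * n₂ * (2 * n₃ + 1) / (2 * ((n₁ : ℝ) + n₂ + n₃) - 1)) := by
  have hK := card_idx_sub_two_pos (n₂ := n₂) (n₃ := n₃) h₁
  -- Split off the dimension `2n₁n₂` of the mixed summand; what remains is the contribution of one
  -- unit vector.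
  rw [show (n₁ : ℝ) * n₂ * (2 * n₃ + 1) / (2 * ((n₁ : ℝ) + n₂ + n₃) - 1) =
    2 * n₁ * n₂ * ((2 * n₃ + 1) / (2 * (2 * ((n₁ : ℝ) + n₂ + n₃) - 1))) by
      rw [← card_idx_sub_two]; field_simp, ← finrank_summand_mixedLabel (n₃ := n₃) ε]
  refine isStructureConstant_of_forall (killingForm_self_neg (two_lt_card_idx h₁))
    fun v hv hv1 y z hy hz => ?_
  rw [sum_killingForm_lie_sq_eq v (sum_sq_shortLabel h₁ hy)
      (sum_sq_shortLabel h₁ hz),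
    sum_killingForm_lie_skewUnit_sq v (blkEmb α) (blkEmb (!α)) realEmb_injective
      (blkEmb_ne_realEmb α) (blkEmb_ne_realEmb (!α))
      (fun c c' => apply_eq_zero_of_mem_mixedLabel hv (by simp [blk_realEmb])), ← card_idx_sub_two]
  have := sum_sq_of_mem_mixedLabel hv hv1 α
  rw [Fintype.card_fin]
  push_cast
  field_simp
  linear_combination this

theorem flagStructureConstant_long_mixed_mixed (h₁ : 1 < n₁) (α : Bool) :
    FlagStructureConstant n₁ n₂ n₃ (longLabel α) (mixedLabel false) (mixedLabel true)
      ((n₁ : ℝ) * n₂ * (blkSize n₁ n₂ α - 1) / (2 * ((n₁ : ℝ) + n₂ + n₃) - 1)) := by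
  have hK := card_idx_sub_two_pos (n₂ := n₂) (n₃ := n₃) h₁
  rw [show (n₁ : ℝ) * n₂ * (blkSize n₁ n₂ α - 1) / (2 * ((n₁ : ℝ) + n₂ + n₃) - 1) =
      (blkSize n₁ n₂ α * (blkSize n₁ n₂ α - 1)) *
        (blkSize n₁ n₂ (!α) / (2 * ((n₁ : ℝ) + n₂ + n₃) - 1)) by
      cases α <;> simp only [blkSize, Bool.not_false, Bool.not_true] <;> ring,
    ← finrank_summand_longLabel (n₃ := n₃)]
  refine isStructureConstant_of_forall (killingForm_self_neg (two_lt_card_idx h₁))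
    fun v hv hv1 y z hy hz => ?_
  -- Both bracket arguments run over the joint basis of the two mixed summands. The common block is
  -- the complex block other than `α`, of real size twice `blkSize n₁ n₂ (!α)`.
  have key := sum_killingForm_lie_sq_eq v (sum_sq_mixedLabel h₁ α hy hz)
    (sum_sq_mixedLabel h₁ α hy hz)
  rw [sum_killingForm_lie_skewUnit_sq v (blkEmb α) (blkEmb α) (blkEmb_injective (!α))
      (blkEmb_ne_blkEmb_not α) (blkEmb_ne_blkEmb_not α)
      (fun c c' => apply_eq_zero_of_mem_longLabel hv (by simp [blk_blkEmb]))] at key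
  -- Of the four parts of the joint double sum, the two unmixed ones vanish by weights and the two
  -- mixed ones agree, so the total is twice the wanted sum.
  have h33 (s t) : killingForm ℝ (G n₁ n₂ n₃) v ⁅(y s : G n₁ n₂ n₃), (y t : G n₁ n₂ n₃)⁆ = 0 := by
    refine killingForm_lie_eq_zero_of_summand hv (y s).2 (y t).2 ?_ ?_ ?_ ?_ ?_ ?_ <;>
      cases α <;> decide
  have h44 (s t) : killingForm ℝ (G n₁ n₂ n₃) v ⁅(z s : G n₁ n₂ n₃), (z t : G n₁ n₂ n₃)⁆ = 0 := by
    refine killingForm_lie_eq_zero_of_summand hv (z s).2 (z t).2 ?_ ?_ ?_ ?_ ?_ ?_ <;>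
      cases α <;> decide
  have h43 (s t) : killingForm ℝ (G n₁ n₂ n₃) v ⁅(z s : G n₁ n₂ n₃), (y t : G n₁ n₂ n₃)⁆ ^ 2 =
      killingForm ℝ (G n₁ n₂ n₃) v ⁅(y t : G n₁ n₂ n₃), (z s : G n₁ n₂ n₃)⁆ ^ 2 := by
    rw [killingForm_lie_swap_right, neg_sq]
  simp only [Fintype.sum_sum_type, Sum.elim_inl, Sum.elim_inr, h33, h44, h43, ne_eq,
    OfNat.ofNat_ne_zero, not_false_eq_true, zero_pow, Finset.sum_const_zero, zero_add,
    add_zero] at key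
  rw [Finset.sum_comm (s := (Finset.univ : Finset (Fin (Module.finrank ℝ
    (summand n₁ n₂ n₃ (mixedLabel true))))))] at key
  have := sum_sq_of_mem_longLabel hv hv1
  rw [← card_idx_sub_two]
  simp only [Fintype.card_prod, Fintype.card_fin] at key
  push_cast at key
  field_simp at key ⊢
  linear_combination ((Fintype.card (Idx n₁ n₂ n₃) : ℝ) - 2) / 2 * key +
    (blkSize n₁ n₂ (!α) : ℝ) * this

theorem flagStructureConstant_eq_zero (h₁ : 1 < n₁) {i j k : Label}
    (a1 : ({i, j, k} : Multiset Label) ≠ {.one, .three, .four})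
    (a2 : ({i, j, k} : Multiset Label) ≠ {.two, .three, .four})
    (a3 : ({i, j, k} : Multiset Label) ≠ {.three, .five, .six})
    (a4 : ({i, j, k} : Multiset Label) ≠ {.four, .five, .six})
    (a5 : ({i, j, k} : Multiset Label) ≠ {.one, .five, .five})
    (a6 : ({i, j, k} : Multiset Label) ≠ {.two, .six, .six}) :
    FlagStructureConstant n₁ n₂ n₃ i j k 0 := by
  rw [← mul_zero (Module.finrank ℝ (summand n₁ n₂ n₃ i) : ℝ)]
  refine isStructureConstant_of_forall (killingForm_self_neg (two_lt_card_idx h₁))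
    fun v hv _ y z _ _ => ?_
  refine Finset.sum_eq_zero fun s _ => Finset.sum_eq_zero fun t _ => ?_
  rw [killingForm_lie_eq_zero_of_summand hv (y s).2 (z t).2 a1 a2 a3 a4 a5 a6]
  exact zero_pow two_ne_zero

end Values

end FlagManifold

open FlagManifold in
theorem mainTheorem3 (n₁ n₂ n₃ : ℕ) (h₁ : 1 < n₁) (h₂ : 1 < n₂) (h₃ : 1 < n₃) :
    (∀ i j k : Label, ({i, j, k} : Multiset Label) = {.one, .three, .four} →
      FlagStructureConstant n₁ n₂ n₃ i j k
        ((n₁ : ℝ) * n₂ * (n₁ - 1) / (2 * ((n₁ : ℝ) + n₂ + n₃) - 1))) ∧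
    (∀ i j k : Label, ({i, j, k} : Multiset Label) = {.two, .three, .four} →
      FlagStructureConstant n₁ n₂ n₃ i j k
        ((n₁ : ℝ) * n₂ * (n₂ - 1) / (2 * ((n₁ : ℝ) + n₂ + n₃) - 1))) ∧
    (∀ i j k : Label, ({i, j, k} : Multiset Label) = {.three, .five, .six} →
      FlagStructureConstant n₁ n₂ n₃ i j k
        ((n₁ : ℝ) * n₂ * (2 * n₃ + 1) / (2 * ((n₁ : ℝ) + n₂ + n₃) - 1))) ∧
    (∀ i j k : Label, ({i, j, k} : Multiset Label) = {.four, .five, .six} →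
      FlagStructureConstant n₁ n₂ n₃ i j k
        ((n₁ : ℝ) * n₂ * (2 * n₃ + 1) / (2 * ((n₁ : ℝ) + n₂ + n₃) - 1))) ∧
    (∀ i j k : Label, ({i, j, k} : Multiset Label) = {.one, .five, .five} →
      FlagStructureConstant n₁ n₂ n₃ i j k
        ((n₁ : ℝ) * (n₁ - 1) * (2 * n₃ + 1) / (2 * ((n₁ : ℝ) + n₂ + n₃) - 1))) ∧
    (∀ i j k : Label, ({i, j, k} : Multiset Label) = {.two, .six, .six} →
      FlagStructureConstant n₁ n₂ n₃ i j k
        ((n₂ : ℝ) * (n₂ - 1) * (2 * n₃ + 1) / (2 * ((n₁ : ℝ) + n₂ + n₃) - 1))) ∧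
    (∀ i j k : Label,
      ({i, j, k} : Multiset Label) ≠ {.one, .three, .four} →
      ({i, j, k} : Multiset Label) ≠ {.two, .three, .four} →
      ({i, j, k} : Multiset Label) ≠ {.three, .five, .six} →
      ({i, j, k} : Multiset Label) ≠ {.four, .five, .six} →
      ({i, j, k} : Multiset Label) ≠ {.one, .five, .five} →
      ({i, j, k} : Multiset Label) ≠ {.two, .six, .six} →
      FlagStructureConstant n₁ n₂ n₃ i j k 0) := by
  have perm {i j k a b d : Label} {c : ℝ} (h : ({i, j, k} : Multiset Label) = {a, b, d})
      (hc : FlagStructureConstant n₁ n₂ n₃ a b d c) : FlagStructureConstant n₁ n₂ n₃ i j k c :=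
    isStructureConstant_of_perm (F := summand n₁ n₂ n₃) h hc
  exact ⟨fun i j k h => perm h (flagStructureConstant_long_mixed_mixed h₁ false),
    fun i j k h => perm h (flagStructureConstant_long_mixed_mixed h₁ true),
    fun i j k h => perm h (flagStructureConstant_mixed_short_short h₁ false false),
    fun i j k h => perm h (flagStructureConstant_mixed_short_short h₁ true false),
    fun i j k h => perm h (flagStructureConstant_long_short_short h₁ false),
    fun i j k h => perm h (flagStructureConstant_long_short_short h₁ true),
    fun i j k => flagStructureConstant_eq_zero h₁⟩
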